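/- **Proposition 3.3 (hypersurface integral of the gain term).** Indices are raised and lowered with $\eta=\mathrm{diag}(-1,1,1,1)$, so that $x^\mu y_\mu=-x^0y^0+\sum_{i=1}^3x^iy^i$. For $p\in\mathbb R^3$ put $p^0=\sqrt{1+|p|^2}$ and $p^\mu=(p^0,p)$. A 4-vector $a^\mu$ is *space-like* if $a^\mu a_\mu>0$, and $b^\mu$ is an *energy-momentum vector* if $b^\mu b_\mu=-1$ and $b^0>0$. Let $\|f\|_{L^1_\rho}=\int_{\mathbb R^3}(p^0)^\rho|f(p)|\,dp$, and let $L^1_\rho$ be the space of measurable $f$ on $\mathbb R^3$ with $\|f\|_{L^1_\rho}<\infty$. Put $$s=-(p^\mu+q^\mu)(p_\mu+q_\mu),\quad g=\sqrt{(p^\mu-q^\mu)(p_\mu-q_\mu)},\quad \cos\theta=\frac{(p^\mu-q^\mu)(p'_\mu-q'_\mu)}{g^2}\ \ (\theta\in[0,\pi]).$$ For a map $\Phi:\mathbb R^n\to\mathbb R^m$, $\delta(\Phi(x))\,dx$ denotes the unique (if it exists) locally finite Borel measure $\nu$ on $\mathbb R^n$ such that $\int\varphi\,d\nu=\lim_{\varepsilon\to0^+}\frac1{|B(0,\varepsilon)|}\int_{\{|\Phi(x)|<\varepsilon\}}\varphi(x)\,dx$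 for all continuous compactly supported $\varphi$, where $B(0,\varepsilon)\subset\mathbb R^m$ is the Euclidean ball. Given a measurable scattering kernel $\sigma(g,\theta)$, the gain term of the relativistic Boltzmann collision operator is, for $f\ge 0$, $$Q^+(f,f)(p)=\frac1{p^0}\int_{\mathbb R^3}\frac{dq}{q^0}\int_{\mathbb R^3}\frac{dq'}{q'^0}\int_{\mathbb R^3}\frac{dp'}{p'^0}\;\tfrac12\,s\,\sigma(g,\theta)\,\delta^{(4)}(p^\mu+q^\mu-p'^\mu-q'^\mu)\,f(p')f(q')\in[0,\infty].$$ The measures $\delta^{(4)}(p^\mu+q^\mu-p'^\mu-q'^\mu)\,dp'\,dq'$ on $\mathbb R^3\times\mathbb R^3$ (for all $p\neq q$ in $\mathbb R^3$) and $\delta(a^\mu(p_\mu-b_\mu))\,dp$ on $\mathbb R^3$ (for all space-like $a^\mu$ and energy-momentum vectors $b^\mu$) exist. Moreover, for all $c_1,c_2>0$ there is a constant $C>0$, depending only on $c_1,c_2$, such that for every measurable $\sigma$ with $c_1g\le\sigma(g,\theta)\le c_2g$ for all $g>0$, $\theta\in[0,\pi]$, every space-like $a^\mu$, every energy-momentum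 vector $b^\mu$, and every non-negative $f\in L^1_1(\mathbb R^3)$, $$\int_{\mathbb R^3}(p^0)^{1/2}\,Q^+(f,f)(p)\,\delta\big(a^\mu(p_\mu-b_\mu)\big)\,dp\;\le\;\frac{C}{\sqrt{a^\mu a_\mu}}\,\|f\|_{L^1_{1/2}}^2 .$$ -/

import Mathlib

open MeasureTheory Filter Topology

noncomputable section

namespace RelBoltzmann

/-- Momentum space `ℝ³`, with the Euclidean norm and Lebesgue measure. -/
abbrev Momentum := EuclideanSpace ℝ (Fin 3)

/-- Four-vectors `x^μ`, `μ = 0, 1, 2, 3`, by their (upper) components. -/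
abbrev FourVector := EuclideanSpace ℝ (Fin 4)

/-- The Lorentz inner product `x^μ y_μ` for the metric `diag(-1, 1, 1, 1)`. -/
def lorentz (x y : FourVector) : ℝ :=
  -(x 0 * y 0) + ∑ i : Fin 3, x i.succ * y i.succ

/-- `a^μ` is space-like if `a^μ a_μ > 0`. -/
def IsSpaceLike (a : FourVector) : Prop := 0 < lorentz a a

/-- `b^μ` is an energy-momentum vector: `b^μ b_μ = -1` and `b⁰ > 0`. -/
def IsEnergyMomentum (b : FourVector) : Prop := lorentz b b = -1 ∧ 0 < b 0

/-- The energy `p⁰ = √(1 + |p|²)`. -/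
def energy (p : Momentum) : ℝ := √(1 + ‖p‖ ^ 2)

/-- The energy-momentum vector `p^μ = (p⁰, p)` of a particle with momentum `p`. -/
def fourMomentum (p : Momentum) : FourVector :=
  WithLp.toLp 2 (Fin.cons (energy p) (fun i : Fin 3 => p i))

/-- `s(p^μ, q^μ) = -(p^μ + q^μ)(p_μ + q_μ)`. -/
def sInv (p q : Momentum) : ℝ :=
  -lorentz (fourMomentum p + fourMomentum q) (fourMomentum p + fourMomentum q)

/-- The relative momentum `g(p^μ, q^μ) = √((p^μ - q^μ)(p_μ - q_μ))`. -/
def gRel (p q : Momentum) : ℝ :=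
  √(lorentz (fourMomentum p - fourMomentum q) (fourMomentum p - fourMomentum q))

/-- The scattering angle, `cos θ = (p^μ - q^μ)(p'_μ - q'_μ) / g²`, with `θ ∈ [0, π]`. -/
def scatteringAngle (p q p' q' : Momentum) : ℝ :=
  Real.arccos (lorentz (fourMomentum p - fourMomentum q) (fourMomentum p' - fourMomentum q')
    / gRel p q ^ 2)

/-- The hard-ball hypothesis `σ(g, θ) ≈ g`, with explicit constants `c₁`, `c₂`. -/
def IsHardBall (c₁ c₂ : ℝ) (σ : ℝ → ℝ → ℝ) : Prop :=
  Measurable (Function.uncurry σ) ∧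
    ∀ g θ : ℝ, 0 < g → θ ∈ Set.Icc 0 Real.pi → c₁ * g ≤ σ g θ ∧ σ g θ ≤ c₂ * g

/-- The weighted norm `‖f‖_{L¹_ρ} = ∫ (p⁰)^ρ |f(p)| dp`, with values in `[0, ∞]`. -/
def weightedL1Norm (ρ : ℝ) (f : Momentum → ℝ) : ENNReal :=
  ∫⁻ p, ENNReal.ofReal (energy p ^ ρ * |f p|)

/-- The weighted space `L¹_ρ(ℝ³)`. -/
def MemWeightedL1 (ρ : ℝ) (f : Momentum → ℝ) : Prop :=
  AEMeasurable f ∧ weightedL1Norm ρ f < ⊤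

section Dirac

variable {X Y : Type*} [TopologicalSpace X] [MeasureSpace X]
  [NormedAddCommGroup Y] [MeasureSpace Y]

/-- `ν` is the measure `δ(Φ(x)) dx`, where `δ` is the Dirac delta function at the origin of `Y`:
it is locally finite, and `∫ φ(x) δ_ε(Φ(x)) dx → ∫ φ dν` as `ε → 0+` for every continuous
compactly supported `φ`, where `δ_ε` is the approximate delta function `1_{B(0, ε)} / |B(0, ε)|`
on `Y`. -/
def IsDiracPullback (Φ : X → Y) (ν : Measure X) : Prop :=
  IsLocallyFiniteMeasure ν ∧
    ∀ φ : X → ℝ, Continuous φ → HasCompactSupport φ →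
      Tendsto
        (fun ε : ℝ => (volume.real (Metric.ball (0 : Y) ε))⁻¹ *
          ∫ x in Φ ⁻¹' Metric.ball (0 : Y) ε, φ x)
        (𝓝[>] 0) (𝓝 (∫ x, φ x ∂ν))

/-- There is at most one measure `δ(Φ(x)) dx`. -/
theorem IsDiracPullback.unique [T2Space X] [LocallyCompactSpace X] [SecondCountableTopology X]
    [BorelSpace X] {Φ : X → Y} {ν₁ ν₂ : Measure X}
    (h₁ : IsDiracPullback Φ ν₁) (h₂ : IsDiracPullback Φ ν₂) : ν₁ = ν₂ := by
  have := h₁.1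
  have := h₂.1
  refine Measure.ext_of_integral_eq_on_compactlySupported (fun φ => ?_)
  exact tendsto_nhds_unique (h₁.2 φ φ.continuous φ.hasCompactSupport)
    (h₂.2 φ φ.continuous φ.hasCompactSupport)

open Classical in
/-- The measure `δ(Φ(x)) dx` (and the zero measure if there is none). -/
def diracPullback (Φ : X → Y) : Measure X :=
  if h : ∃ ν : Measure X, IsDiracPullback Φ ν then h.choose else 0

end Dirac

/-- The map `(p', q') ↦ p^μ + q^μ - p'^μ - q'^μ`. -/
def conservationDefect (p q : Momentum) (z : Momentum × Momentum) : FourVector :=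
  fourMomentum p + fourMomentum q - fourMomentum z.1 - fourMomentum z.2

/-- The measure `δ⁽⁴⁾(p^μ + q^μ - p'^μ - q'^μ) dp' dq'` on the pairs `(p', q')`. -/
def collisionMeasure (p q : Momentum) : Measure (Momentum × Momentum) :=
  diracPullback (conservationDefect p q)

/-- The gain term, for non-negative `f` and `h`, as an element of `[0, ∞]`:
`Q⁺(f, h)(p) = (1/p⁰) ∫ dq/q⁰ ∫ dq'/q'⁰ ∫ dp'/p'⁰ W(p, q | p', q') f(p') h(q')` with
`W(p, q | p', q') = (1/2) s σ(g, θ) δ⁽⁴⁾(p^μ + q^μ - p'^μ - q'^μ)`. -/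
def gain (σ : ℝ → ℝ → ℝ) (f h : Momentum → ℝ) (p : Momentum) : ENNReal :=
  ENNReal.ofReal (1 / energy p) *
    ∫⁻ q, ENNReal.ofReal (1 / energy q) *
      ∫⁻ z, ENNReal.ofReal (1 / (energy z.1 * energy z.2) *
          (1 / 2 * sInv p q * σ (gRel p q) (scatteringAngle p q z.1 z.2)) *
          (f z.1 * h z.2))
        ∂(collisionMeasure p q)

/-- The function `p ↦ a^μ (p_μ - b_μ)`, whose zero set is the hypersurface. -/
def hyperplaneFun (a b : FourVector) (p : Momentum) : ℝ :=
  lorentz a (fourMomentum p - b)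

/-- The measure `δ(a^μ (p_μ - b_μ)) dp` on `ℝ³`. -/
def hypersurfaceMeasure (a b : FourVector) : Measure Momentum :=
  diracPullback (hyperplaneFun a b)

end RelBoltzmann

end

namespace RelBoltzmann

/-! Fix the total four-momentum `v` of a pair. In its centre-of-momentum frame the two particles fly
apart along a unit vector `ω` with momentum `ρ = cmMomentum v` and energy `m = cmEnergy v`, so the
pairs with total `v` form a sphere. Boosts and polar coordinates disintegrate `dp dq` over `v` into
measures on these spheres with density `ρ p⁰ q⁰ / (2m)` (`lintegral_eq_lintegral_collisionPair`).
The density and the parametrization are continuous in `v`, so the fibre over `v = p^μ + q^μ` is the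
collision measure; the hypersurface measure arises likewise from cylindrical coordinates along the
spatial part of `a`.

The gain term integrates over the sphere of outgoing pairs, which depends on `(p, q)` only through
`v`. Integrated over the layer `|a^μ(p_μ - b_μ)| < ε`, it therefore factors at each `v` into an
integral of `f(p') f(q')` over the sphere and the weighted size of the layer on the same sphere
(`lintegral_total_mul`). On the sphere the layer is a zone: `a^μ(p_μ - b_μ)` is affine in `ω`, with
slope `ρ` times the length of the spatial part of `a` in the centre-of-momentum frame, and that
length is at least `√(a^μ a_μ)`. By Archimedes' hat-box estimate the zone has area `O(ε / (ρ √(a^μ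
a_μ)))`. The factor `1/ρ` cancels against the density, `m² ≤ p'⁰ q'⁰` and `√(p'⁰ + q'⁰) ≤ 2 √p'⁰
√q'⁰` absorb the remaining weights, and the disintegration read backwards gives the squared norm
(`lintegral_layer_weightedGain_le`).

The passage from layers to the hypersurface, a null set, needs regularity. By Vitali–Carathéodory,
`f` lies below a lower semicontinuous `F` of almost the same norm. By Fatou, the gain of `F` for `σ
= c₂ g` is lower semicontinuous, and so is its integral over the fibre at height `y`, at `y = 0`;
bounds on the averages over layers then bound the value at `0` (`lintegral_hypersurfaceMeasure_le`).
-/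

/-! ### Cylindrical and polar coordinates, and the area of spherical zones. -/

/-- Prepend a coordinate to a Euclidean vector. -/
def euclideanCons (n : ℕ) (x : ℝ × EuclideanSpace ℝ (Fin n)) : EuclideanSpace ℝ (Fin (n + 1)) :=
  WithLp.toLp 2 (Fin.cons x.1 (fun i => x.2 i))

theorem measurePreserving_euclideanCons (n : ℕ) :
    MeasurePreserving (euclideanCons n) volume volume := by
  have h1 : MeasurePreserving (Prod.map id (@WithLp.ofLp 2 (Fin n → ℝ)) :
      ℝ × EuclideanSpace ℝ (Fin n) → ℝ × (Fin n → ℝ)) volume volume :=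
    (MeasurePreserving.id volume).prod (PiLp.volume_preserving_ofLp (Fin n))
  have h2 := (volume_preserving_piFinSuccAbove (fun _ : Fin (n + 1) => ℝ) 0).symm
  have h3 := PiLp.volume_preserving_toLp (Fin (n + 1))
  have h : euclideanCons n = WithLp.toLp 2 ∘
      (MeasurableEquiv.piFinSuccAbove (fun _ : Fin (n + 1) => ℝ) 0).symm ∘
      Prod.map id (@WithLp.ofLp 2 (Fin n → ℝ)) := by
    funext x
    refine congrArg (WithLp.toLp 2) ?_
    simp [MeasurableEquiv.piFinSuccAbove]
    rfl
  rw [h]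
  exact h3.comp (h2.comp h1)

@[simp] theorem euclideanCons_zero (n : ℕ) (x : ℝ × EuclideanSpace ℝ (Fin n)) :
    euclideanCons n x 0 = x.1 := rfl

@[simp] theorem euclideanCons_succ (n : ℕ) (x : ℝ × EuclideanSpace ℝ (Fin n)) (i : Fin n) :
    euclideanCons n x i.succ = x.2 i := rfl

theorem norm_euclideanCons_sq (n : ℕ) (x : ℝ × EuclideanSpace ℝ (Fin n)) :
    ‖euclideanCons n x‖ ^ 2 = x.1 ^ 2 + ‖x.2‖ ^ 2 := by
  simp [EuclideanSpace.norm_sq_eq, Fin.sum_univ_succ]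

theorem continuous_euclideanCons (n : ℕ) : Continuous (euclideanCons n) := by
  refine (PiLp.continuous_toLp 2 _).comp (continuous_pi fun i => ?_)
  refine Fin.cases ?_ (fun i => ?_) i
  · simpa using continuous_fst
  · simp only [Fin.cons_succ]
    fun_prop

/-- Cylindrical coordinates `p = l e + t` along a unit vector `e`. -/
theorem exists_measurePreserving_frame (e : Momentum) (he : ‖e‖ = 1) :
    ∃ P : ℝ × EuclideanSpace ℝ (Fin 2) → Momentum, Continuous P ∧
      MeasurePreserving P volume volume ∧
      (∀ l t, inner ℝ e (P (l, t)) = l) ∧ (∀ l t, ‖P (l, t)‖ ^ 2 = l ^ 2 + ‖t‖ ^ 2) ∧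
      (∀ l t, P (l, t) = l • e + P (0, t)) := by
  set e₀ : Momentum := euclideanCons 2 (1, 0) with he₀
  have hn : ‖e₀‖ = ‖e‖ := by
    rw [he, ← sq_eq_sq₀ (norm_nonneg _) zero_le_one, norm_euclideanCons_sq]
    simp
  -- Two vectors of equal length are exchanged by the reflection in the hyperplane bisecting them.
  obtain ⟨R, hR⟩ : ∃ R : Momentum ≃ₗᵢ[ℝ] Momentum, R e₀ = e :=
    ⟨(ℝ ∙ (e₀ - e))ᗮ.reflection, Submodule.reflection_sub hn⟩
  refine ⟨fun x => R (euclideanCons 2 x), R.continuous.comp (continuous_euclideanCons 2),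
    R.measurePreserving.comp (measurePreserving_euclideanCons 2), fun l t => ?_, fun l t => ?_,
    fun l t => ?_⟩
  · rw [← hR]
    refine (R.inner_map_map _ _).trans ?_
    simp [he₀, PiLp.inner_apply, Fin.sum_univ_succ, euclideanCons]
  · rw [R.norm_map, norm_euclideanCons_sq]
  · rw [← hR, ← map_smul, ← map_add]
    refine congrArg R ?_
    ext i
    refine Fin.cases ?_ (fun i => ?_) i
    · simp [he₀, euclideanCons]
    · simp [he₀, euclideanCons]

theorem lintegral_comp_mul_deriv_of_surjective {f f' : ℝ → ℝ} (hf : ∀ x, HasDerivAt f (f' x) x)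
    (hmono : Monotone f) (hsurj : Function.Surjective f) (F : ℝ → ENNReal) :
    ∫⁻ x, F x = ∫⁻ x, ENNReal.ofReal (f' x) * F (f x) := by
  have := lintegral_image_eq_lintegral_deriv_mul_of_monotoneOn MeasurableSet.univ
    (fun x _ => (hf x).hasDerivWithinAt) (hmono.monotoneOn _) F
  simpa [hsurj.range_eq] using this

theorem lintegral_eq_lintegral_sphere {E : Type*} [NormedAddCommGroup E] [NormedSpace ℝ E]
    [MeasurableSpace E] [BorelSpace E] [FiniteDimensional ℝ E] [Nontrivial E] (μ : Measure E)
    [μ.IsAddHaarMeasure] {F : E → ENNReal} (hF : Measurable F) :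
    ∫⁻ x, F x ∂μ = ∫⁻ ω, ∫⁻ r in Set.Ioi (0 : ℝ),
      ENNReal.ofReal (r ^ (Module.finrank ℝ E - 1)) * F (r • (ω : E)) ∂volume ∂μ.toSphere := by
  have h := μ.measurePreserving_homeomorphUnitSphereProd
  have h2 := h.lintegral_comp_emb (Homeomorph.measurableEmbedding _)
    (fun z => F ((z.2 : ℝ) • (z.1 : E)))
  have hmeas : Measurable (fun z : Metric.sphere (0 : E) 1 × Set.Ioi (0 : ℝ) =>
      F ((z.2 : ℝ) • (z.1 : E))) := by
    apply hF.comp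
    fun_prop
  calc ∫⁻ x, F x ∂μ = ∫⁻ x in ({0}ᶜ : Set E), F x ∂μ := by rw [restrict_compl_singleton]
    _ = ∫⁻ x : ({0}ᶜ : Set E), F x ∂(μ.comap (↑)) := by
      rw [lintegral_subtype_comap (measurableSet_singleton _).compl]
    _ = ∫⁻ z, F ((z.2 : ℝ) • (z.1 : E)) ∂(μ.toSphere.prod
        (Measure.volumeIoiPow (Module.finrank ℝ E - 1))) := by
      rw [← h2]
      refine lintegral_congr fun x => ?_
      congr 1
      have hx : ‖(x : E)‖ ≠ 0 := norm_ne_zero_iff.2 x.2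
      simp [homeomorphUnitSphereProd, homeomorphSphereProd, smul_smul, hx]
    _ = ∫⁻ ω, ∫⁻ r : Set.Ioi (0 : ℝ), F ((r : ℝ) • (ω : E))
          ∂(Measure.volumeIoiPow (Module.finrank ℝ E - 1)) ∂μ.toSphere :=
      lintegral_prod _ hmeas.aemeasurable
    _ = _ := by
      refine lintegral_congr fun ω => ?_
      change ∫⁻ r, (F ∘ fun r : Set.Ioi (0 : ℝ) => (r : ℝ) • (ω : E)) r ∂_ = _
      rw [Measure.volumeIoiPow, lintegral_withDensity_eq_lintegral_mul _ (by fun_prop)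
        (hF.comp (f := fun r : Set.Ioi (0 : ℝ) => (r : ℝ) • (ω : E)) (by fun_prop)),
        ← lintegral_subtype_comap measurableSet_Ioi]
      rfl

theorem lintegral_plane_norm {h : ℝ → ENNReal} (hh : Measurable h) :
    ∫⁻ t : EuclideanSpace ℝ (Fin 2), h ‖t‖ =
      ENNReal.ofReal (2 * Real.pi) * ∫⁻ r in Set.Ioi (0 : ℝ), ENNReal.ofReal r * h r := by
  rw [lintegral_eq_lintegral_sphere volume (F := fun t => h ‖t‖) (hh.comp measurable_norm)]
  have : ∀ ω : Metric.sphere (0 : EuclideanSpace ℝ (Fin 2)) 1,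
      ∫⁻ r in Set.Ioi (0 : ℝ), ENNReal.ofReal (r ^ (Module.finrank ℝ (EuclideanSpace ℝ (Fin 2)) - 1))
        * h ‖r • (ω : EuclideanSpace ℝ (Fin 2))‖ =
      ∫⁻ r in Set.Ioi (0 : ℝ), ENNReal.ofReal r * h r := fun ω => by
    refine setLIntegral_congr_fun measurableSet_Ioi fun r hr => ?_
    have hr : 0 < r := hr
    simp [norm_smul, abs_of_pos hr]
  simp_rw [this]
  rw [lintegral_const, mul_comm, Measure.toSphere_apply_univ, EuclideanSpace.volume_ball_fin_two]
  congr 1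
  rw [ENNReal.ofReal_mul zero_le_two]
  simp [ENNReal.ofReal, Real.toNNReal_of_nonneg Real.pi_pos.le]

/-- With `r = √(l² + y²)` one has `y dy = r dr`; only an inequality remains because `r` misses the
values up to `|l|`. In the coordinates (height, radius) the volume element is thus at most `2π r dl
dr`, which is Archimedes' observation. -/
theorem lintegral_mul_comp_sqrt_le (l : ℝ) (G : ℝ → ENNReal) :
    ∫⁻ y in Set.Ioi (0 : ℝ), ENNReal.ofReal y * G (√(l ^ 2 + y ^ 2)) ≤
      ∫⁻ r in Set.Ioi (0 : ℝ), ENNReal.ofReal r * G r := by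
  have hpos : ∀ y ∈ Set.Ioi (0 : ℝ), 0 < l ^ 2 + y ^ 2 := fun y (hy : 0 < y) => by positivity
  have hd : ∀ y ∈ Set.Ioi (0 : ℝ), HasDerivWithinAt (fun y => √(l ^ 2 + y ^ 2))
      (y / √(l ^ 2 + y ^ 2)) (Set.Ioi 0) y := fun y hy => by
    have h1 : HasDerivAt (fun y : ℝ => l ^ 2 + y ^ 2) (2 * y) y := by
      simpa using (hasDerivAt_pow 2 y).const_add (l ^ 2)
    have h2 := h1.sqrt (hpos y hy).ne'
    rw [mul_div_mul_left _ _ two_ne_zero] at h2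
    exact h2.hasDerivWithinAt
  have hm : MonotoneOn (fun y => √(l ^ 2 + y ^ 2)) (Set.Ioi 0) := fun x hx y hy hxy => by
    have hx : 0 < x := hx
    refine Real.sqrt_le_sqrt ?_
    gcongr
  have h := lintegral_image_eq_lintegral_deriv_mul_of_monotoneOn measurableSet_Ioi hd hm
    (fun r => ENNReal.ofReal r * G r)
  calc _ = ∫⁻ y in Set.Ioi (0 : ℝ), ENNReal.ofReal (y / √(l ^ 2 + y ^ 2)) *
        (ENNReal.ofReal (√(l ^ 2 + y ^ 2)) * G (√(l ^ 2 + y ^ 2))) := by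
        refine setLIntegral_congr_fun measurableSet_Ioi fun y hy => ?_
        have h3 := Real.sqrt_pos.2 (hpos y hy)
        have hy' : (0 : ℝ) < y := hy
        rw [← mul_assoc, ← ENNReal.ofReal_mul (by positivity), div_mul_cancel₀ _ h3.ne']
    _ = _ := h.symm
    _ ≤ _ := by
        refine lintegral_mono_set ?_
        rintro _ ⟨y, hy, rfl⟩
        exact Real.sqrt_pos.2 (hpos y hy)

open scoped Pointwise in
/-- Archimedes' hat-box estimate: the area of a spherical zone is controlled by its width. -/
theorem toSphere_unit_zone_le (e : Momentum) (he : ‖e‖ = 1) (k δ : ℝ) (hδ : 0 < δ) :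
    (volume : Measure Momentum).toSphere {ω | |inner ℝ e (ω : Momentum) - k| < δ} ≤
      ENNReal.ofReal (12 * Real.pi * δ) := by
  have hS : MeasurableSet {ω : Metric.sphere (0 : Momentum) 1 |
      |inner ℝ e (ω : Momentum) - k| < δ} :=
    (isOpen_lt (by fun_prop) continuous_const).measurableSet
  obtain ⟨P, hPc, hP, hPe, hPn, -⟩ := exists_measurePreserving_frame e he
  -- The cone over the zone inside the unit ball, in the coordinates (height along `e`, radius). The
  -- area of the zone is by definition of `toSphere` three times the volume of this cone.
  set A : Set (ℝ × ℝ) := {z | z.2 < 1} ∩ {z | |z.1 - k * z.2| < δ * z.2} with hA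
  have hAm : MeasurableSet A :=
    (measurableSet_lt (by fun_prop) (by fun_prop)).inter
      (measurableSet_lt (by fun_prop) (by fun_prop))
  set G : ℝ × ℝ → ENNReal := A.indicator 1 with hG
  have hGm : Measurable G := measurable_one.indicator hAm
  have hsub : Set.Ioo (0 : ℝ) 1 • ((↑) '' {ω : Metric.sphere (0 : Momentum) 1 |
      |inner ℝ e (ω : Momentum) - k| < δ} : Set Momentum) ⊆
      {x | (inner ℝ e x, ‖x‖) ∈ A} := by
    rintro _ ⟨r, hr, _, ⟨ω, hω, rfl⟩, rfl⟩
    have hω1 : ‖(ω : Momentum)‖ = 1 := by simp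
    simp only [Set.mem_ofPred_eq, Set.mem_inter_iff, hA, norm_smul, hω1,
      Real.norm_eq_abs, abs_of_pos hr.1, mul_one, inner_smul_right]
    refine ⟨hr.2, ?_⟩
    rw [show r * inner ℝ e (ω : Momentum) - k * r = r * (inner ℝ e (ω : Momentum) - k) by ring,
      abs_mul, abs_of_pos hr.1, mul_comm δ]
    exact mul_lt_mul_of_pos_left hω hr.1
  have hvol : (volume : Measure Momentum) {x | (inner ℝ e x, ‖x‖) ∈ A} ≤
      ENNReal.ofReal (4 * Real.pi * δ) := by
    have hBm : MeasurableSet {x : Momentum | (inner ℝ e x, ‖x‖) ∈ A} :=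
      hAm.preimage (by fun_prop)
    calc (volume : Measure Momentum) {x | (inner ℝ e x, ‖x‖) ∈ A}
        = ∫⁻ x : Momentum, G (inner ℝ e x, ‖x‖) := by
          rw [← lintegral_indicator_one hBm]
          rfl
      _ = ∫⁻ z, G (inner ℝ e (P z), ‖P z‖) :=
          (hP.lintegral_comp (f := fun x => G (inner ℝ e x, ‖x‖)) (hGm.comp (by fun_prop))).symm
      _ = ∫⁻ l, ∫⁻ t, G (inner ℝ e (P (l, t)), ‖P (l, t)‖) :=
          lintegral_prod _ (hGm.comp (by fun_prop)).aemeasurable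
      _ = ∫⁻ l, ∫⁻ t : EuclideanSpace ℝ (Fin 2), G (l, √(l ^ 2 + ‖t‖ ^ 2)) := by
          simp_rw [hPe, ← hPn, Real.sqrt_sq (norm_nonneg _)]
      _ = ∫⁻ l, ENNReal.ofReal (2 * Real.pi) *
            ∫⁻ y in Set.Ioi (0 : ℝ), ENNReal.ofReal y * G (l, √(l ^ 2 + y ^ 2)) :=
          lintegral_congr fun l =>
            lintegral_plane_norm (h := fun y => G (l, √(l ^ 2 + y ^ 2))) (hGm.comp (by fun_prop))
      _ ≤ ∫⁻ l, ENNReal.ofReal (2 * Real.pi) *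
            ∫⁻ r in Set.Ioi (0 : ℝ), ENNReal.ofReal r * G (l, r) :=
          lintegral_mono fun l => mul_le_mul_right (lintegral_mul_comp_sqrt_le l _) _
      _ = ENNReal.ofReal (2 * Real.pi) *
            ∫⁻ l, ∫⁻ r in Set.Ioi (0 : ℝ), ENNReal.ofReal r * G (l, r) :=
          lintegral_const_mul' _ _ ENNReal.ofReal_ne_top
      _ = ENNReal.ofReal (2 * Real.pi) *
            ∫⁻ r in Set.Ioi (0 : ℝ), ∫⁻ l, ENNReal.ofReal r * G (l, r) := by
          rw [lintegral_lintegral_swap]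
          exact Measurable.aemeasurable (by fun_prop)
      _ ≤ ENNReal.ofReal (2 * Real.pi) *
            ∫⁻ r in Set.Ioi (0 : ℝ), (Set.Ioo (0 : ℝ) 1).indicator
              (fun _ => ENNReal.ofReal (2 * δ)) r := by
          refine mul_le_mul_right (setLIntegral_mono' measurableSet_Ioi fun r hr => ?_) _
          have hr : 0 < r := hr
          rw [lintegral_const_mul' _ _ ENNReal.ofReal_ne_top]
          by_cases h1 : r < 1
          · rw [Set.indicator_of_mem (show r ∈ Set.Ioo (0 : ℝ) 1 from ⟨hr, h1⟩)]
            have : ∫⁻ l, G (l, r) ≤ ENNReal.ofReal (2 * (δ * r)) := by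
              calc ∫⁻ l, G (l, r) ≤ ∫⁻ l, (Metric.ball (k * r) (δ * r)).indicator 1 l := by
                    refine lintegral_mono fun l => ?_
                    refine Set.indicator_le_indicator_of_subset (f := 1) (s := {l | (l, r) ∈ A})
                      (fun l hl => ?_) (fun _ => zero_le) l
                    exact hl.2
                _ = _ := by
                    rw [lintegral_indicator_one Metric.isOpen_ball.measurableSet, Real.volume_ball]
            calc _ ≤ ENNReal.ofReal r * ENNReal.ofReal (2 * (δ * r)) := mul_le_mul_right this _
              _ ≤ _ := by
                rw [← ENNReal.ofReal_mul hr.le]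
                refine ENNReal.ofReal_le_ofReal ?_
                -- Bounding `r²` by `1` instead of integrating it loses a factor `3`, whence `12π`
                -- and not `4π`.
                have : r * r ≤ 1 := by nlinarith
                nlinarith
          · have : ∀ l, G (l, r) = 0 := fun l =>
              Set.indicator_of_notMem (fun h => h1 h.1) _
            simp [this]
      _ ≤ ENNReal.ofReal (2 * Real.pi) * ENNReal.ofReal (2 * δ) := by
          refine mul_le_mul_right ?_ _
          calc _ ≤ ∫⁻ r, (Set.Ioo (0 : ℝ) 1).indicator (fun _ => ENNReal.ofReal (2 * δ)) r :=
                setLIntegral_le_lintegral _ _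
            _ = _ := by rw [lintegral_indicator_const measurableSet_Ioo]; simp
      _ = _ := by
          rw [← ENNReal.ofReal_mul (by positivity)]
          congr 1
          ring
  rw [Measure.toSphere_apply' _ hS]
  calc _ ≤ (3 : ENNReal) * ENNReal.ofReal (4 * Real.pi * δ) := by
        refine mul_le_mul' (by simp) ((measure_mono hsub).trans hvol)
    _ = _ := by
        rw [show (3 : ENNReal) = ENNReal.ofReal 3 by simp, ← ENNReal.ofReal_mul (by norm_num)]
        congr 1
        ring

theorem toSphere_zone_le (u : Momentum) (hu : u ≠ 0) (k ε : ℝ) (hε : 0 < ε) :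
    (volume : Measure Momentum).toSphere {ω | |k + inner ℝ u (ω : Momentum)| < ε} ≤
      ENNReal.ofReal (12 * Real.pi * (ε / ‖u‖)) := by
  have hu' : 0 < ‖u‖ := norm_pos_iff.2 hu
  convert toSphere_unit_zone_le (‖u‖⁻¹ • u) (by simp [norm_smul, hu'.ne']) (-(k / ‖u‖)) (ε / ‖u‖)
    (by positivity) using 4 with ω
  rw [real_inner_smul_left, sub_neg_eq_add,
    show ‖u‖⁻¹ * inner ℝ u (ω : Momentum) + k / ‖u‖ = (k + inner ℝ u (ω : Momentum)) / ‖u‖ by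
      field_simp; ring, abs_div, abs_of_pos hu', div_lt_div_iff_of_pos_right hu']

/-! ### Lower semicontinuity, averages over small balls, and Dirac measures from disintegrations. -/

/-- Fatou's lemma along the countably generated filter `𝓝 x`. -/
theorem LowerSemicontinuousAt.lintegral_param {α T : Type*} [TopologicalSpace α]
    [FirstCountableTopology α] [MeasurableSpace T] {μ : Measure T} {f : α → T → ENNReal} {x : α}
    (hm : ∀ x, Measurable (f x)) (hf : ∀ t, LowerSemicontinuousAt (fun x => f x t) x) :
    LowerSemicontinuousAt (fun x => ∫⁻ t, f x t ∂μ) x := by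
  rw [lowerSemicontinuousAt_iff_le_liminf]
  calc ∫⁻ t, f x t ∂μ ≤ ∫⁻ t, liminf (fun y => f y t) (𝓝 x) ∂μ :=
        lintegral_mono fun t => (hf t).le_liminf
    _ ≤ _ := lintegral_liminf_le hm

theorem LowerSemicontinuousAt.ennreal_mul {α : Type*} [TopologicalSpace α] {f g : α → ENNReal}
    {x : α} (hf : LowerSemicontinuousAt f x) (hg : LowerSemicontinuousAt g x) :
    LowerSemicontinuousAt (fun x => f x * g x) x := by
  rw [lowerSemicontinuousAt_iff_le_liminf] at *
  exact (mul_le_mul' hf hg).trans ENNReal.le_liminf_mul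

section Average

variable {Y : Type*} [NormedAddCommGroup Y] [MeasureSpace Y] [OpensMeasurableSpace Y]
  [ProperSpace Y] [(volume : Measure Y).IsOpenPosMeasure]
  [IsFiniteMeasureOnCompacts (volume : Measure Y)]

/-- For `b < L 0`, lower semicontinuity gives `b < L` on a small ball, so the average there is at
least `b`. This turns estimates on layers into an estimate on the fibre over `0`. -/
theorem LowerSemicontinuousAt.le_of_lintegral_ball_le {L : Y → ENNReal}
    (hL : LowerSemicontinuousAt L 0) {M : ENNReal}
    (h : ∀ ε : ℝ, 0 < ε → ∫⁻ y in Metric.ball (0 : Y) ε, L y ≤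
      M * volume (Metric.ball (0 : Y) ε)) : L 0 ≤ M := by
  refine le_of_forall_lt fun a ha => ?_
  obtain ⟨b, hab, hb⟩ := exists_between ha
  obtain ⟨ε, hε, hball⟩ := Metric.eventually_nhds_iff_ball.1 (hL b hb)
  have h0 : volume (Metric.ball (0 : Y) ε) ≠ 0 := (Metric.measure_ball_pos _ _ hε).ne'
  have h1 : volume (Metric.ball (0 : Y) ε) ≠ ⊤ := measure_ball_lt_top.ne
  have h2 : b * volume (Metric.ball (0 : Y) ε) ≤ M * volume (Metric.ball (0 : Y) ε) := by
    refine le_trans ?_ (h ε hε)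
    rw [← setLIntegral_const]
    exact setLIntegral_mono' Metric.isOpen_ball.measurableSet fun y hy => (hball y hy).le
  exact hab.trans_le ((ENNReal.mul_le_mul_iff_left h0 h1).1 h2)

theorem tendsto_laverage_ball {L : Y → ENNReal} (hL : ContinuousAt L 0) :
    Tendsto (fun ε : ℝ => (volume (Metric.ball (0 : Y) ε))⁻¹ *
      ∫⁻ y in Metric.ball (0 : Y) ε, L y) (𝓝[>] 0) (𝓝 (L 0)) := by
  have key : ∀ (p : ENNReal → Prop), (∀ᶠ y in 𝓝 (0 : Y), p (L y)) →
      ∀ᶠ ε : ℝ in 𝓝[>] 0, (0 < ε ∧ ∀ y ∈ Metric.ball (0 : Y) ε, p (L y)) := fun p hp => by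
    obtain ⟨ε₀, hε₀, hball⟩ := Metric.eventually_nhds_iff_ball.1 hp
    filter_upwards [Ioo_mem_nhdsGT hε₀] with ε hε
    exact ⟨hε.1, fun y hy => hball y (Metric.ball_subset_ball hε.2.le hy)⟩
  have hv : ∀ ε : ℝ, 0 < ε → ∀ b : ENNReal, (volume (Metric.ball (0 : Y) ε))⁻¹ *
      ∫⁻ _ in Metric.ball (0 : Y) ε, b = b := fun ε hε b => by
    rw [setLIntegral_const, mul_left_comm, ENNReal.inv_mul_cancel
      (Metric.measure_ball_pos _ _ hε).ne' measure_ball_lt_top.ne, mul_one]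
  refine tendsto_order.2 ⟨fun a ha => ?_, fun a ha => ?_⟩
  · obtain ⟨b, hab, hb⟩ := exists_between ha
    filter_upwards [key (b < ·) (hL.eventually_const_lt hb)] with ε hε
    refine hab.trans_le ?_
    rw [← hv ε hε.1 b]
    gcongr 1
    exact setLIntegral_mono' Metric.isOpen_ball.measurableSet fun y hy => (hε.2 y hy).le
  · obtain ⟨b, hab, hb⟩ := exists_between ha
    filter_upwards [key (· < b) (hL.eventually_lt_const hab)] with ε hε
    refine lt_of_le_of_lt ?_ hb
    rw [← hv ε hε.1 b]
    gcongr 1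
    exact setLIntegral_mono' Metric.isOpen_ball.measurableSet fun y hy => (hε.2 y hy).le

variable {X : Type*} [TopologicalSpace X] [MeasureSpace X] [BorelSpace X]
  [IsFiniteMeasureOnCompacts (volume : Measure X)]

/-- A family of measures `ν y` on the fibres of `Φ` which disintegrates the volume and is vaguely
continuous at `0` has `ν 0 = δ(Φ(x)) dx`. -/
theorem isDiracPullback_of_disintegration {Φ : X → Y} {ν : Y → Measure X}
    (hfin : IsLocallyFiniteMeasure (ν 0))
    (hdis : ∀ F : X → ENNReal, Measurable F → ∀ ε : ℝ,
      ∫⁻ x in Φ ⁻¹' Metric.ball 0 ε, F x = ∫⁻ y in Metric.ball (0 : Y) ε, ∫⁻ x, F x ∂ν y)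
    (hcont : ∀ φ : X → ℝ, Continuous φ → HasCompactSupport φ →
      ContinuousAt (fun y => ∫⁻ x, ENNReal.ofReal (φ x) ∂ν y) 0) :
    IsDiracPullback Φ (ν 0) := by
  refine ⟨hfin, fun φ hφ hsupp => ?_⟩
  -- The disintegration concerns `∫⁻`, so non-negative test functions come first; a general one is
  -- split into positive and negative parts.
  have pos : ∀ φ : X → ℝ, Continuous φ → HasCompactSupport φ → (∀ x, 0 ≤ φ x) →
      Tendsto (fun ε : ℝ => (volume.real (Metric.ball (0 : Y) ε))⁻¹ *
          ∫ x in Φ ⁻¹' Metric.ball (0 : Y) ε, φ x)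
        (𝓝[>] 0) (𝓝 (∫ x, φ x ∂ν 0)) := fun φ hφ hsupp h0 => by
    have hm : Measurable fun x => ENNReal.ofReal (φ x) := hφ.measurable.ennreal_ofReal
    have hlim := tendsto_laverage_ball (hcont φ hφ hsupp)
    have hint : ∫⁻ x, ENNReal.ofReal (φ x) ∂ν 0 ≠ ⊤ :=
      (hφ.integrable_of_hasCompactSupport hsupp).lintegral_lt_top.ne
    have := (ENNReal.tendsto_toReal hint).comp hlim
    rw [integral_eq_lintegral_of_nonneg_ae (.of_forall h0) hφ.measurable.aestronglyMeasurable]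
    refine this.congr fun ε => ?_
    rw [integral_eq_lintegral_of_nonneg_ae (.of_forall h0) hφ.measurable.aestronglyMeasurable,
      hdis _ hm]
    simp [Measure.real]
  have hp := pos (fun x => max (φ x) 0) (by fun_prop)
    (hsupp.comp_left (g := fun r => max r 0) (by simp)) fun x => le_max_right _ _
  have hn := pos (fun x => max (-φ x) 0) (by fun_prop)
    (hsupp.comp_left (g := fun r => max (-r) 0) (by simp)) fun x => le_max_right _ _
  have hi : ∀ μ : Measure X, IsFiniteMeasureOnCompacts μ →
      Integrable (fun x => max (φ x) 0) μ ∧ Integrable (fun x => max (-φ x) 0) μ := fun μ hμ =>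
    ⟨Continuous.integrable_of_hasCompactSupport (by fun_prop)
      (hsupp.comp_left (g := fun r => max r 0) (by simp)),
    Continuous.integrable_of_hasCompactSupport (by fun_prop)
      (hsupp.comp_left (g := fun r => max (-r) 0) (by simp))⟩
  have hsub : ∀ x, φ x = max (φ x) 0 - max (-φ x) 0 := fun x => by
    rcases le_total (φ x) 0 with h | h
    · rw [max_eq_right h, max_eq_left (by linarith)]; ring
    · rw [max_eq_left h, max_eq_right (by linarith)]; ring
  have hint : ∀ μ : Measure X, IsFiniteMeasureOnCompacts μ → ∫ x, φ x ∂μ =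
      ∫ x, max (φ x) 0 ∂μ - ∫ x, max (-φ x) 0 ∂μ := fun μ hμ => by
    rw [← integral_sub (hi μ hμ).1 (hi μ hμ).2]
    exact integral_congr_ae (.of_forall hsub)
  rw [hint (ν 0) inferInstance]
  refine (hp.sub hn).congr fun ε => ?_
  rw [← mul_sub]
  congr 1
  rw [← integral_sub (hi volume inferInstance).1.restrict (hi volume inferInstance).2.restrict]
  exact integral_congr_ae (.of_forall fun x => (hsub x).symm)

end Average

/-! ### Lorentz algebra and the hypersurface measure. -/

/-- The spatial part of a four-vector. -/
def spatial (a : FourVector) : Momentum := WithLp.toLp 2 fun i => a i.succ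

theorem lorentz_eq (x y : FourVector) :
    lorentz x y = -(x 0 * y 0) + inner ℝ (spatial x) (spatial y) := by
  simp [lorentz, spatial, PiLp.inner_apply, mul_comm]

@[simp] theorem fourMomentum_zero (p : Momentum) : fourMomentum p 0 = energy p := rfl

@[simp] theorem spatial_fourMomentum (p : Momentum) : spatial (fourMomentum p) = p := rfl

@[simp] theorem spatial_add (x y : FourVector) : spatial (x + y) = spatial x + spatial y := rfl

@[simp] theorem spatial_sub (x y : FourVector) : spatial (x - y) = spatial x - spatial y := rfl

theorem lorentz_sub_right (a x y : FourVector) : lorentz a (x - y) = lorentz a x - lorentz a y := by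
  simp [lorentz_eq, inner_sub_right]
  ring

theorem hyperplaneFun_eq (a b : FourVector) (p : Momentum) :
    hyperplaneFun a b p = -(a 0 * energy p) + inner ℝ (spatial a) p - lorentz a b := by
  rw [hyperplaneFun, lorentz_sub_right, lorentz_eq a (fourMomentum p)]
  simp

theorem energy_pos (p : Momentum) : 0 < energy p := Real.sqrt_pos.2 (by positivity)

theorem energy_sq (p : Momentum) : energy p ^ 2 = 1 + ‖p‖ ^ 2 := Real.sq_sqrt (by positivity)

@[fun_prop]
theorem continuous_energy : Continuous energy := by
  unfold energy
  fun_prop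

@[fun_prop]
theorem continuous_hyperplaneFun (a b : FourVector) : Continuous (hyperplaneFun a b) := by
  simp_rw [funext (hyperplaneFun_eq a b)]
  fun_prop

section Hyperbola

variable {d a₀ τ : ℝ}

/-- Space-likeness enters as `|a₀| ≤ d`. The bound fixes the sign when a square root is extracted,
and makes the Jacobian non-negative and bounded. -/
theorem hyperbola_abs_le (hd : 0 < d) (h : 0 < d ^ 2 - a₀ ^ 2) (hτ : 0 < τ) (k : ℝ) :
    |a₀ * k| ≤ d * √(k ^ 2 + (d ^ 2 - a₀ ^ 2) * τ) := by
  have h1 : |a₀| ≤ d := abs_le_of_sq_le_sq (by linarith) hd.le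
  have h2 : |k| ≤ √(k ^ 2 + (d ^ 2 - a₀ ^ 2) * τ) :=
    Real.abs_le_sqrt (by nlinarith [mul_pos h hτ])
  rw [abs_mul]
  exact mul_le_mul h1 h2 (abs_nonneg _) hd.le

/-- The solution `l` of `-a₀ √(τ + l²) + d l = k`. -/
noncomputable def hyperbolaRoot (d a₀ τ k : ℝ) : ℝ :=
  (d * k + a₀ * √(k ^ 2 + (d ^ 2 - a₀ ^ 2) * τ)) / (d ^ 2 - a₀ ^ 2)

theorem hasDerivAt_hyperbolaRoot (h : 0 < d ^ 2 - a₀ ^ 2) (hτ : 0 < τ) (k : ℝ) :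
    HasDerivAt (hyperbolaRoot d a₀ τ)
      ((d + a₀ * (k / √(k ^ 2 + (d ^ 2 - a₀ ^ 2) * τ))) / (d ^ 2 - a₀ ^ 2)) k := by
  have hpos : 0 < k ^ 2 + (d ^ 2 - a₀ ^ 2) * τ := by positivity
  have h1 : HasDerivAt (fun k : ℝ => k ^ 2 + (d ^ 2 - a₀ ^ 2) * τ) (2 * k) k := by
    simpa using (hasDerivAt_pow 2 k).add_const ((d ^ 2 - a₀ ^ 2) * τ)
  have h2 := h1.sqrt hpos.ne'
  rw [mul_div_mul_left _ _ two_ne_zero] at h2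
  have h3 := (((hasDerivAt_id k).const_mul d).add (h2.const_mul a₀)).div_const (d ^ 2 - a₀ ^ 2)
  rw [mul_one] at h3
  exact h3

theorem hyperbolaRoot_deriv_nonneg (hd : 0 < d) (h : 0 < d ^ 2 - a₀ ^ 2) (hτ : 0 < τ) (k : ℝ) :
    0 ≤ (d + a₀ * (k / √(k ^ 2 + (d ^ 2 - a₀ ^ 2) * τ))) / (d ^ 2 - a₀ ^ 2) := by
  have hs : 0 < √(k ^ 2 + (d ^ 2 - a₀ ^ 2) * τ) := Real.sqrt_pos.2 (by positivity)
  have := (abs_le.1 (hyperbola_abs_le hd h hτ k)).1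
  refine div_nonneg ?_ h.le
  rw [← mul_div_assoc, show d + a₀ * k / √(k ^ 2 + (d ^ 2 - a₀ ^ 2) * τ) =
    (d * √(k ^ 2 + (d ^ 2 - a₀ ^ 2) * τ) + a₀ * k) / √(k ^ 2 + (d ^ 2 - a₀ ^ 2) * τ) by
      field_simp]
  exact div_nonneg (by linarith) hs.le

theorem hyperbolaRoot_deriv_le (hd : 0 < d) (h : 0 < d ^ 2 - a₀ ^ 2) (hτ : 0 < τ) (k : ℝ) :
    (d + a₀ * (k / √(k ^ 2 + (d ^ 2 - a₀ ^ 2) * τ))) / (d ^ 2 - a₀ ^ 2) ≤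
      2 * d / (d ^ 2 - a₀ ^ 2) := by
  have hs : 0 < √(k ^ 2 + (d ^ 2 - a₀ ^ 2) * τ) := Real.sqrt_pos.2 (by positivity)
  have := (abs_le.1 (hyperbola_abs_le hd h hτ k)).2
  have h2 : a₀ * (k / √(k ^ 2 + (d ^ 2 - a₀ ^ 2) * τ)) ≤ d := by
    rw [← mul_div_assoc, div_le_iff₀ hs]
    exact this
  gcongr
  linarith

theorem hyperbolaRoot_spec (hd : 0 < d) (h : 0 < d ^ 2 - a₀ ^ 2) (hτ : 0 < τ) (k : ℝ) :
    -(a₀ * √(τ + hyperbolaRoot d a₀ τ k ^ 2)) + d * hyperbolaRoot d a₀ τ k = k := by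
  have hs := Real.sq_sqrt (show 0 ≤ k ^ 2 + (d ^ 2 - a₀ ^ 2) * τ by positivity)
  have := (abs_le.1 (hyperbola_abs_le hd h hτ k)).1
  unfold hyperbolaRoot
  set S := √(k ^ 2 + (d ^ 2 - a₀ ^ 2) * τ)
  -- At the root, `τ + l²` is a perfect square.
  have h1 : τ + ((d * k + a₀ * S) / (d ^ 2 - a₀ ^ 2)) ^ 2 =
      ((a₀ * k + d * S) / (d ^ 2 - a₀ ^ 2)) ^ 2 := by
    field_simp
    linear_combination (-(d ^ 2 - a₀ ^ 2)) * hs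
  rw [h1, Real.sqrt_sq (div_nonneg (by linarith) h.le)]
  field_simp
  ring

theorem hyperbolaRoot_surjective (hd : 0 < d) (h : 0 < d ^ 2 - a₀ ^ 2) (hτ : 0 < τ) :
    Function.Surjective (hyperbolaRoot d a₀ τ) := fun l => by
  refine ⟨-(a₀ * √(τ + l ^ 2)) + d * l, ?_⟩
  have hs := Real.sq_sqrt (show 0 ≤ τ + l ^ 2 by positivity)
  have h1 : |a₀| ≤ d := abs_le_of_sq_le_sq (by linarith) hd.le
  have h2 : |l| ≤ √(τ + l ^ 2) := Real.abs_le_sqrt (by linarith)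
  have h3 : |a₀ * l| ≤ d * √(τ + l ^ 2) := by
    rw [abs_mul]
    exact mul_le_mul h1 h2 (abs_nonneg _) hd.le
  have h4 := (abs_le.1 h3).2
  unfold hyperbolaRoot
  set S := √(τ + l ^ 2)
  -- The discriminant at the value attained by `l` is a perfect square, with `d * S - a₀ * l ≥ 0`.
  rw [show (-(a₀ * S) + d * l) ^ 2 + (d ^ 2 - a₀ ^ 2) * τ = (d * S - a₀ * l) ^ 2 by
    linear_combination (a₀ ^ 2 - d ^ 2) * hs, Real.sqrt_sq (by linarith)]
  field_simp
  ring

end Hyperbola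

theorem lorentz_self_eq {a : FourVector} :
    lorentz a a = ‖spatial a‖ ^ 2 - a 0 ^ 2 := by
  rw [lorentz_eq, real_inner_self_eq_norm_sq]
  ring

theorem lintegral_eq_of_measurePreserving_prod {X T : Type*} [MeasureSpace X] [MeasureSpace T]
    [SFinite (volume : Measure T)] {P : ℝ × T → X} (hP : MeasurePreserving P volume volume)
    {F : X → ENNReal} (hF : Measurable F) : ∫⁻ x, F x = ∫⁻ t, ∫⁻ l, F (P (l, t)) := by
  rw [← hP.lintegral_comp hF]
  exact lintegral_prod_symm (fun z => F (P z)) (hF.comp hP.measurable).aemeasurable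

/-- Coordinates `(y, t)` of momentum space in which the value of `hyperplaneFun a b` is `y`. -/
theorem exists_hypersurface_coordinates {a : FourVector} (ha : IsSpaceLike a) (b : FourVector) :
    ∃ (j : ℝ → EuclideanSpace ℝ (Fin 2) → ℝ) (θ : ℝ → EuclideanSpace ℝ (Fin 2) → Momentum) (M : ℝ),
      Continuous (Function.uncurry j) ∧ Continuous (Function.uncurry θ) ∧
      (∀ y t, 0 ≤ j y t) ∧ (∀ y t, j y t ≤ M) ∧ (∀ y t, ‖t‖ ≤ ‖θ y t‖) ∧
      ∀ G : ℝ → Momentum → ENNReal, Measurable (Function.uncurry G) →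
        ∫⁻ p, G (hyperplaneFun a b p) p = ∫⁻ y, ∫⁻ t, ENNReal.ofReal (j y t) * G y (θ y t) := by
  have h : 0 < ‖spatial a‖ ^ 2 - a 0 ^ 2 := by rw [← lorentz_self_eq]; exact ha
  have hd : 0 < ‖spatial a‖ := by
    rcases (norm_nonneg (spatial a)).eq_or_lt with h0 | h0
    · rw [← h0] at h
      nlinarith [sq_nonneg (a 0)]
    · exact h0
  set d := ‖spatial a‖ with hd_def
  -- With the axis along the spatial part of `a`, the function is `-a₀ √(τ + l²) + d l - κ`, `τ = 1
  -- + ‖t‖²`. At fixed `t` it is inverted in `l` by `hyperbolaRoot`.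
  obtain ⟨P, hPc, hP, hPe, hPn, -⟩ := exists_measurePreserving_frame (d⁻¹ • spatial a)
    (by rw [norm_smul, ← hd_def, Real.norm_eq_abs, abs_of_pos (inv_pos.2 hd), inv_mul_cancel₀ hd.ne'])
  have hτ : ∀ t : EuclideanSpace ℝ (Fin 2), 0 < 1 + ‖t‖ ^ 2 := fun t => by positivity
  have hS : ∀ (t : EuclideanSpace ℝ (Fin 2)) (k : ℝ),
      √(k ^ 2 + (d ^ 2 - a 0 ^ 2) * (1 + ‖t‖ ^ 2)) ≠ 0 := fun t k =>
    (Real.sqrt_pos.2 (add_pos_of_nonneg_of_pos (sq_nonneg _) (mul_pos h (hτ t)))).ne'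
  set κ := lorentz a b
  have hΦ : ∀ l t, hyperplaneFun a b (P (l, t)) = -(a 0 * √(1 + ‖t‖ ^ 2 + l ^ 2)) + d * l - κ := by
    intro l t
    have h1 : inner ℝ (spatial a) (P (l, t)) = d * l := by
      have := hPe l t
      rw [real_inner_smul_left] at this
      rw [← div_eq_inv_mul, div_eq_iff hd.ne'] at this
      rw [this, mul_comm]
    rw [hyperplaneFun_eq, h1, energy, hPn, add_comm (l ^ 2), ← add_assoc]
  refine ⟨fun y t => (d + a 0 * ((y + κ) / √((y + κ) ^ 2 + (d ^ 2 - a 0 ^ 2) * (1 + ‖t‖ ^ 2)))) /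
      (d ^ 2 - a 0 ^ 2), fun y t => P (hyperbolaRoot d (a 0) (1 + ‖t‖ ^ 2) (y + κ), t),
    2 * d / (d ^ 2 - a 0 ^ 2), ?_, ?_, fun y t => hyperbolaRoot_deriv_nonneg hd h (hτ t) _,
    fun y t => hyperbolaRoot_deriv_le hd h (hτ t) _, fun y t => ?_, fun G hG => ?_⟩
  · simp only [Function.uncurry_def]
    refine Continuous.div_const (continuous_const.add (continuous_const.mul
      (Continuous.div (by fun_prop) (by fun_prop) fun z => hS _ _))) _
  · simp only [Function.uncurry_def, hyperbolaRoot]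
    fun_prop
  · refine le_of_sq_le_sq ?_ (norm_nonneg _)
    rw [hPn]
    nlinarith [sq_nonneg (hyperbolaRoot d (a 0) (1 + ‖t‖ ^ 2) (y + κ))]
  · have hG' : Measurable fun p => G (hyperplaneFun a b p) p :=
      hG.comp ((continuous_hyperplaneFun a b).measurable.prodMk measurable_id)
    rw [lintegral_eq_of_measurePreserving_prod hP hG']
    refine Eq.trans ?_ (lintegral_lintegral_swap ?_).symm
    · refine lintegral_congr fun t => ?_
      have hmono : Monotone (hyperbolaRoot d (a 0) (1 + ‖t‖ ^ 2)) :=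
        monotone_of_deriv_nonneg (fun k => (hasDerivAt_hyperbolaRoot h (hτ t) k).differentiableAt)
          fun k => by
            rw [(hasDerivAt_hyperbolaRoot h (hτ t) k).deriv]
            exact hyperbolaRoot_deriv_nonneg hd h (hτ t) k
      rw [lintegral_comp_mul_deriv_of_surjective (hasDerivAt_hyperbolaRoot h (hτ t)) hmono
        (hyperbolaRoot_surjective hd h (hτ t)),
        ← lintegral_add_right_eq_self _ κ]
      refine lintegral_congr fun y => ?_
      rw [hΦ, hyperbolaRoot_spec hd h (hτ t), add_sub_cancel_right]
    · refine Measurable.aemeasurable ?_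
      refine Measurable.mul (Measurable.ennreal_ofReal ?_) (hG.comp (measurable_fst.prodMk ?_))
      · exact Measurable.div_const (measurable_const.add (measurable_const.mul
          (Measurable.div (by fun_prop) (by fun_prop)))) _
      · simp only [hyperbolaRoot]
        exact hPc.measurable.comp (by fun_prop)

theorem lintegral_map_withDensity {T X : Type*} [MeasurableSpace T] [MeasurableSpace X]
    (μ : Measure T) {j : T → ENNReal} {θ : T → X} {F : X → ENNReal} (hj : Measurable j)
    (hθ : Measurable θ) (hF : Measurable F) :
    ∫⁻ x, F x ∂((μ.withDensity j).map θ) = ∫⁻ t, j t * F (θ t) ∂μ := by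
  rw [lintegral_map hF hθ]
  exact lintegral_withDensity_eq_lintegral_mul _ hj (hF.comp hθ)

/-- The fibres are images of weighted plane measures. Since the density is bounded and `‖t‖ ≤ ‖θ y
t‖`, a bounded set of momenta involves only a bounded set of `t`, uniformly in `y`; this gives local
finiteness and dominated convergence. -/
theorem exists_hypersurfaceMeasure_family {a : FourVector} (ha : IsSpaceLike a) (b : FourVector) :
    ∃ ν : ℝ → Measure Momentum, IsDiracPullback (hyperplaneFun a b) (ν 0) ∧
      (∀ F : Momentum → ENNReal, Measurable F → ∀ ε : ℝ,
        ∫⁻ p in hyperplaneFun a b ⁻¹' Metric.ball 0 ε, F p =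
          ∫⁻ y in Metric.ball (0 : ℝ) ε, ∫⁻ p, F p ∂ν y) ∧
      ∀ F : Momentum → ENNReal, LowerSemicontinuous F →
        LowerSemicontinuousAt (fun y => ∫⁻ p, F p ∂ν y) 0 := by
  obtain ⟨j, θ, M, hj, hθ, hj0, hjM, hθt, hG⟩ := exists_hypersurface_coordinates ha b
  have hjy : ∀ y, Continuous (j y) := fun y => hj.comp (Continuous.prodMk_right y)
  have hθy : ∀ y, Continuous (θ y) := fun y => hθ.comp (Continuous.prodMk_right y)
  have hjt : ∀ t, Continuous fun y => j y t := fun t => hj.comp (Continuous.prodMk_left t)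
  have hθt' : ∀ t, Continuous fun y => θ y t := fun t => hθ.comp (Continuous.prodMk_left t)
  set ν : ℝ → Measure Momentum := fun y =>
    (volume.withDensity fun t => ENNReal.ofReal (j y t)).map (θ y) with hν
  have hint : ∀ y (F : Momentum → ENNReal), Measurable F →
      ∫⁻ p, F p ∂ν y = ∫⁻ t, ENNReal.ofReal (j y t) * F (θ y t) := fun y F hF => by
    exact lintegral_map_withDensity _ (hjy y).measurable.ennreal_ofReal (hθy y).measurable hF
  have hdis : ∀ F : Momentum → ENNReal, Measurable F → ∀ ε : ℝ,
        ∫⁻ p in hyperplaneFun a b ⁻¹' Metric.ball 0 ε, F p =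
          ∫⁻ y in Metric.ball (0 : ℝ) ε, ∫⁻ p, F p ∂ν y := fun F hF ε => by
    have hB : MeasurableSet (Metric.ball (0 : ℝ) ε) := Metric.isOpen_ball.measurableSet
    have h1 := hG (fun y p => (Metric.ball (0 : ℝ) ε).indicator 1 y * F p)
      (((measurable_one.indicator hB).comp measurable_fst).mul (hF.comp measurable_snd))
    rw [← lintegral_indicator (hB.preimage (continuous_hyperplaneFun a b).measurable),
      ← lintegral_indicator hB]
    convert h1 using 1
    · refine lintegral_congr fun p => ?_
      by_cases hp : hyperplaneFun a b p ∈ Metric.ball 0 ε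
      · rw [Set.indicator_of_mem (show p ∈ hyperplaneFun a b ⁻¹' Metric.ball 0 ε from hp),
          Set.indicator_of_mem hp]
        simp
      · rw [Set.indicator_of_notMem (show p ∉ hyperplaneFun a b ⁻¹' Metric.ball 0 ε from hp),
          Set.indicator_of_notMem hp, zero_mul]
    · refine lintegral_congr fun y => ?_
      by_cases hy : y ∈ Metric.ball 0 ε
      · simp_rw [Set.indicator_of_mem hy, hint y F hF]
        simp
      · simp_rw [Set.indicator_of_notMem hy]
        simp
  have hfin : IsLocallyFiniteMeasure (ν 0) := by
    refine ⟨fun p => ⟨Metric.ball p 1, Metric.ball_mem_nhds _ one_pos, ?_⟩⟩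
    have hB : MeasurableSet (Metric.ball p 1) := Metric.isOpen_ball.measurableSet
    rw [← lintegral_indicator_one hB, hint 0 _ (measurable_one.indicator hB)]
    calc _ ≤ ∫⁻ t, (Metric.ball (0 : EuclideanSpace ℝ (Fin 2)) (‖p‖ + 1)).indicator
          (fun _ => ENNReal.ofReal M) t := by
          refine lintegral_mono fun t => ?_
          by_cases ht : θ 0 t ∈ Metric.ball p 1
          · have : t ∈ Metric.ball (0 : EuclideanSpace ℝ (Fin 2)) (‖p‖ + 1) := by
              rw [mem_ball_zero_iff]
              rw [mem_ball_iff_norm] at ht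
              have h2 := norm_sub_norm_le (θ 0 t) p
              linarith [hθt 0 t]
            rw [Set.indicator_of_mem ht, Set.indicator_of_mem this]
            simpa using ENNReal.ofReal_le_ofReal (hjM 0 t)
          · simp [Set.indicator_of_notMem ht]
      _ < ⊤ := by
          rw [lintegral_indicator_const Metric.isOpen_ball.measurableSet]
          exact ENNReal.mul_lt_top ENNReal.ofReal_lt_top measure_ball_lt_top
  refine ⟨ν, isDiracPullback_of_disintegration hfin hdis fun φ hφ hsupp => ?_, hdis, fun F hF => ?_⟩
  · have hm : Measurable fun x => ENNReal.ofReal (φ x) := hφ.measurable.ennreal_ofReal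
    simp_rw [hint _ _ hm]
    obtain ⟨R, hR⟩ := hsupp.isCompact.isBounded.subset_ball 0
    obtain ⟨N, hN⟩ := hφ.bounded_above_of_compact_support hsupp
    refine tendsto_lintegral_filter_of_dominated_convergence
      ((Metric.ball (0 : EuclideanSpace ℝ (Fin 2)) R).indicator
        fun _ => ENNReal.ofReal M * ENNReal.ofReal N) ?_ ?_ ?_ ?_
    · exact .of_forall fun y => (hjy y).measurable.ennreal_ofReal.mul (hm.comp (hθy y).measurable)
    · refine .of_forall fun y => .of_forall fun t => ?_
      by_cases ht : t ∈ Metric.ball (0 : EuclideanSpace ℝ (Fin 2)) R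
      · rw [Set.indicator_of_mem ht]
        exact mul_le_mul' (ENNReal.ofReal_le_ofReal (hjM y t))
          (ENNReal.ofReal_le_ofReal ((le_abs_self _).trans (hN _)))
      · have : φ (θ y t) = 0 := by
          by_contra h0
          refine ht ?_
          have := hR (subset_tsupport _ h0)
          rw [mem_ball_zero_iff] at this ⊢
          exact (hθt y t).trans_lt this
        simp [this]
    · rw [lintegral_indicator_const Metric.isOpen_ball.measurableSet]
      exact (ENNReal.mul_lt_top (ENNReal.mul_lt_top ENNReal.ofReal_lt_top ENNReal.ofReal_lt_top)
        measure_ball_lt_top).ne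
    · refine .of_forall fun t => ?_
      have h1 : Continuous fun y => ENNReal.ofReal (j y t) * ENNReal.ofReal (φ (θ y t)) := by
        simp_rw [← ENNReal.ofReal_mul (hj0 _ t)]
        exact ENNReal.continuous_ofReal.comp ((hjt t).mul (hφ.comp (hθt' t)))
      exact h1.tendsto 0
  · simp_rw [hint _ _ hF.measurable]
    refine LowerSemicontinuousAt.lintegral_param
      (fun y => (hjy y).measurable.ennreal_ofReal.mul (hF.measurable.comp (hθy y).measurable))
      fun t => ?_
    refine LowerSemicontinuousAt.ennreal_mul ?_ ?_
    · exact (ENNReal.continuous_ofReal.comp (hjt t)).lowerSemicontinuous 0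
    · exact (hF.comp (hθt' t)) 0

theorem IsDiracPullback.eq_diracPullback {X Y : Type*} [TopologicalSpace X] [MeasureSpace X]
    [NormedAddCommGroup Y] [MeasureSpace Y] [T2Space X] [LocallyCompactSpace X]
    [SecondCountableTopology X] [BorelSpace X] {Φ : X → Y} {ν : Measure X}
    (h : IsDiracPullback Φ ν) : diracPullback Φ = ν := by
  have hex : ∃ ν : Measure X, IsDiracPullback Φ ν := ⟨ν, h⟩
  rw [diracPullback, dif_pos hex]
  exact IsDiracPullback.unique hex.choose_spec h

theorem isDiracPullback_hypersurfaceMeasure {a : FourVector} (ha : IsSpaceLike a) (b : FourVector) :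
    IsDiracPullback (hyperplaneFun a b) (hypersurfaceMeasure a b) := by
  obtain ⟨ν, hν, -⟩ := exists_hypersurfaceMeasure_family ha b
  rw [hypersurfaceMeasure, hν.eq_diracPullback]
  exact hν

theorem lintegral_hypersurfaceMeasure_le {a : FourVector} (ha : IsSpaceLike a) (b : FourVector)
    {F : Momentum → ENNReal} (hF : LowerSemicontinuous F) {M : ENNReal}
    (h : ∀ ε : ℝ, 0 < ε → ∫⁻ p in hyperplaneFun a b ⁻¹' Metric.ball 0 ε, F p ≤
      M * volume (Metric.ball (0 : ℝ) ε)) :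
    ∫⁻ p, F p ∂(hypersurfaceMeasure a b) ≤ M := by
  obtain ⟨ν, hν, hdis, hlsc⟩ := exists_hypersurfaceMeasure_family ha b
  rw [hypersurfaceMeasure, hν.eq_diracPullback]
  refine LowerSemicontinuousAt.le_of_lintegral_ball_le (hlsc F hF) fun ε hε => ?_
  rw [← hdis F hF.measurable]
  exact h ε hε

/-! ### Boosts from the centre-of-momentum frame and their Jacobian. -/

/-- The spatial part of the boost of a vector `y` from the centre-of-momentum frame, in which the
particles have energy `m`, to a frame in which the mean momentum is `c` and the mean energy `E`. -/
noncomputable def boost (m E : ℝ) (c y : Momentum) : Momentum :=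
  y + (inner ℝ c y / (m * (E + m))) • c

theorem boost_neg (m E : ℝ) (c y : Momentum) : boost m E c (-y) = -boost m E c y := by
  simp [boost, neg_div]
  abel

theorem inner_sq_le_of_sq_eq {m : ℝ} {y : Momentum} (c : Momentum) (hm : 0 < m)
    (hm2 : m ^ 2 = 1 + ‖y‖ ^ 2) : (inner ℝ c y / m) ^ 2 ≤ ‖c‖ ^ 2 := by
  have h1 : inner ℝ c y ^ 2 ≤ (‖c‖ * ‖y‖) ^ 2 := by
    rw [← sq_abs]
    exact pow_le_pow_left₀ (abs_nonneg _) (abs_real_inner_le_norm c y) 2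
  rw [div_pow, div_le_iff₀ (by positivity), hm2]
  nlinarith [sq_nonneg ‖c‖]

/-- `c + boost m E c y` is the spatial part of the Lorentz boost of `(m, y)`, and boosts preserve
the mass shell. The sign of the root comes from `|c·y / m| ≤ ‖c‖ ≤ E`. -/
theorem energy_add_boost {m E : ℝ} {c y : Momentum} (hm : 0 < m) (hm2 : m ^ 2 = 1 + ‖y‖ ^ 2)
    (hE : 0 < E) (hE2 : E ^ 2 = m ^ 2 + ‖c‖ ^ 2) :
    energy (c + boost m E c y) = E + inner ℝ c y / m := by
  have h1 := inner_sq_le_of_sq_eq c hm hm2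
  have h2 : |inner ℝ c y / m| ≤ E := abs_le_of_sq_le_sq (by nlinarith) hE.le
  have h3 := (abs_le.1 h2).1
  have h4 : 1 + ‖c + boost m E c y‖ ^ 2 = (E + inner ℝ c y / m) ^ 2 := by
    have hEm : E + m ≠ 0 := by positivity
    have hc : c + boost m E c y = y + (1 + inner ℝ c y / (m * (E + m))) • c := by
      rw [boost, add_smul, one_smul]
      abel
    rw [hc, @norm_add_sq_real, norm_smul, mul_pow, Real.norm_eq_abs, sq_abs, inner_smul_right,
      real_inner_comm c y]
    set s := inner ℝ c y
    have hc2 : ‖c‖ ^ 2 = (E - m) * (E + m) := by linear_combination -hE2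
    have hy2 : ‖y‖ ^ 2 = m ^ 2 - 1 := by linear_combination -hm2
    rw [hc2, hy2]
    field_simp
    ring
  rw [energy, h4, Real.sqrt_sq (by linarith)]

theorem energy_sub_boost {m E : ℝ} {c y : Momentum} (hm : 0 < m) (hm2 : m ^ 2 = 1 + ‖y‖ ^ 2)
    (hE : 0 < E) (hE2 : E ^ 2 = m ^ 2 + ‖c‖ ^ 2) :
    energy (c - boost m E c y) = E - inner ℝ c y / m := by
  rw [sub_eq_add_neg, ← boost_neg, energy_add_boost hm (by rwa [norm_neg]) hE hE2, inner_neg_right,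
    neg_div, sub_eq_add_neg]

section OneDim

variable {τ κ : ℝ}

/-- For `τ = 1 + ‖t‖²` and `κ = ‖c‖²` this function is the action of the boost on the coordinate
along `c`. Both energies vary with `l`, so the map is not linear. -/
theorem hasDerivAt_boost_axis (hτ : 0 < τ) (hκ : 0 ≤ κ) (l : ℝ) :
    HasDerivAt (fun l => l * (√(τ + l ^ 2 + κ) / √(τ + l ^ 2)))
      ((√(τ + l ^ 2 + κ) ^ 2 - κ * l ^ 2 / √(τ + l ^ 2) ^ 2) /
        (√(τ + l ^ 2 + κ) * √(τ + l ^ 2))) l := by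
  have hm : 0 < τ + l ^ 2 := by positivity
  have hE : 0 < τ + l ^ 2 + κ := by positivity
  have h1 : HasDerivAt (fun l : ℝ => τ + l ^ 2) (2 * l) l := by
    simpa using (hasDerivAt_pow 2 l).const_add τ
  have h2 := h1.sqrt hm.ne'
  have h3 := (h1.add_const κ).sqrt hE.ne'
  rw [mul_div_mul_left _ _ two_ne_zero] at h2 h3
  have hm' := Real.sqrt_pos.2 hm
  have hE' := Real.sqrt_pos.2 hE
  have h4 := (hasDerivAt_id l).mul (h3.div h2 hm'.ne')
  refine h4.congr_deriv ?_
  have e1 := Real.sq_sqrt hm.le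
  have e2 := Real.sq_sqrt hE.le
  rw [show ((fun y => √(τ + y ^ 2 + κ)) / fun y => √(τ + y ^ 2)) l =
    √(τ + l ^ 2 + κ) / √(τ + l ^ 2) from rfl, id_eq]
  set m := √(τ + l ^ 2)
  set E := √(τ + l ^ 2 + κ)
  have hκ' : κ = E ^ 2 - m ^ 2 := by rw [e1, e2]; ring
  rw [hκ']
  field_simp
  ring

theorem boost_axis_deriv_nonneg (hτ : 0 < τ) (hκ : 0 ≤ κ) (l : ℝ) :
    0 ≤ (√(τ + l ^ 2 + κ) ^ 2 - κ * l ^ 2 / √(τ + l ^ 2) ^ 2) /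
        (√(τ + l ^ 2 + κ) * √(τ + l ^ 2)) := by
  have hm : 0 < τ + l ^ 2 := by positivity
  rw [Real.sq_sqrt hm.le, Real.sq_sqrt (by positivity)]
  refine div_nonneg ?_ (by positivity)
  have : κ * l ^ 2 / (τ + l ^ 2) ≤ κ := by
    rw [div_le_iff₀ hm]
    nlinarith
  linarith

theorem boost_axis_surjective (hτ : 0 < τ) (hκ : 0 ≤ κ) :
    Function.Surjective (fun l : ℝ => l * (√(τ + l ^ 2 + κ) / √(τ + l ^ 2))) := by
  have h1 : ∀ l : ℝ, 1 ≤ √(τ + l ^ 2 + κ) / √(τ + l ^ 2) := fun l => by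
    rw [one_le_div (Real.sqrt_pos.2 (by positivity))]
    exact Real.sqrt_le_sqrt (by linarith)
  refine Continuous.surjective ?_ ?_ ?_
  · exact continuous_iff_continuousAt.2 fun l => (hasDerivAt_boost_axis hτ hκ l).continuousAt
  · refine tendsto_atTop_mono' _ ?_ tendsto_id
    filter_upwards [eventually_ge_atTop 0] with l hl
    exact le_mul_of_one_le_right hl (h1 l)
  · refine tendsto_atBot_mono' _ ?_ tendsto_id
    filter_upwards [eventually_le_atBot 0] with l hl
    dsimp only [id]
    nlinarith [h1 l]

end OneDim

/-- The change of variables `x = boost y` at fixed mean momentum `c`. -/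
theorem lintegral_eq_lintegral_boost (c : Momentum) {F : Momentum → ENNReal} (hF : Measurable F) :
    ∫⁻ x, F x = ∫⁻ y, ENNReal.ofReal ((√(1 + ‖y‖ ^ 2 + ‖c‖ ^ 2) ^ 2 -
      (inner ℝ c y / energy y) ^ 2) / (√(1 + ‖y‖ ^ 2 + ‖c‖ ^ 2) * energy y)) *
      F (boost (energy y) √(1 + ‖y‖ ^ 2 + ‖c‖ ^ 2) c y) := by
  rcases eq_or_ne c 0 with rfl | hc
  · refine lintegral_congr fun y => ?_
    have h1 := (energy_pos y).ne'
    have h2 : √(1 + ‖y‖ ^ 2 + ‖(0 : Momentum)‖ ^ 2) = energy y := by simp [energy]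
    rw [h2]
    simp only [boost, inner_zero_left, zero_div, smul_zero, add_zero]
    rw [show (energy y ^ 2 - 0 ^ 2) / (energy y * energy y) = 1 by field_simp; ring]
    simp
  have hc' : 0 < ‖c‖ := norm_pos_iff.2 hc
  obtain ⟨P, hPc, hP, hPe, hPn, hPadd⟩ := exists_measurePreserving_frame (‖c‖⁻¹ • c)
    (by simp [norm_smul, hc'.ne'])
  have hτ : ∀ t : EuclideanSpace ℝ (Fin 2), 0 < 1 + ‖t‖ ^ 2 := fun t => by positivity
  have hκ : 0 ≤ ‖c‖ ^ 2 := by positivity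
  have hin : ∀ l t, inner ℝ c (P (l, t)) = ‖c‖ * l := fun l t => by
    have := hPe l t
    rw [real_inner_smul_left, ← div_eq_inv_mul, div_eq_iff hc'.ne'] at this
    rw [this, mul_comm]
  have hEn : ∀ l t, energy (P (l, t)) = √(1 + ‖t‖ ^ 2 + l ^ 2) := fun l t => by
    rw [energy, hPn, add_comm (l ^ 2), add_assoc]
  have hE : ∀ l t, √(1 + ‖P (l, t)‖ ^ 2 + ‖c‖ ^ 2) = √(1 + ‖t‖ ^ 2 + l ^ 2 + ‖c‖ ^ 2) :=
    fun l t => by rw [hPn, add_comm (l ^ 2), ← add_assoc 1]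
  -- Only the coordinate along `c` moves, by the factor `E / m` because `‖c‖² = (E - m)(E + m)`; the
  -- change of variables is one-dimensional at each `t`.
  have hB : ∀ l t, boost (energy (P (l, t))) √(1 + ‖P (l, t)‖ ^ 2 + ‖c‖ ^ 2) c (P (l, t)) =
      P (l * (√(1 + ‖t‖ ^ 2 + l ^ 2 + ‖c‖ ^ 2) / √(1 + ‖t‖ ^ 2 + l ^ 2)), t) := fun l t => by
    have hm : 0 < 1 + ‖t‖ ^ 2 + l ^ 2 := by positivity
    have e1 := Real.sq_sqrt hm.le
    have e2 := Real.sq_sqrt (show 0 ≤ 1 + ‖t‖ ^ 2 + l ^ 2 + ‖c‖ ^ 2 by positivity)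
    rw [boost, hin, hE, hEn, hPadd l, hPadd (l * _)]
    have hm' := Real.sqrt_pos.2 hm
    have hE' : 0 < √(1 + ‖t‖ ^ 2 + l ^ 2 + ‖c‖ ^ 2) := Real.sqrt_pos.2 (by positivity)
    set m := √(1 + ‖t‖ ^ 2 + l ^ 2)
    set E := √(1 + ‖t‖ ^ 2 + l ^ 2 + ‖c‖ ^ 2)
    have hc2 : ‖c‖ ^ 2 = (E - m) * (E + m) := by
      rw [show (E - m) * (E + m) = E ^ 2 - m ^ 2 by ring, e1, e2]; ring
    have : l * (E / m) * ‖c‖⁻¹ = l * ‖c‖⁻¹ + ‖c‖ * l / (m * (E + m)) := by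
      field_simp
      rw [hc2]
      ring
    rw [smul_smul, smul_smul, this, add_smul]
    abel
  have hm0 : Measurable fun y : Momentum => ENNReal.ofReal ((√(1 + ‖y‖ ^ 2 + ‖c‖ ^ 2) ^ 2 -
      (inner ℝ c y / energy y) ^ 2) / (√(1 + ‖y‖ ^ 2 + ‖c‖ ^ 2) * energy y)) *
      F (boost (energy y) √(1 + ‖y‖ ^ 2 + ‖c‖ ^ 2) c y) := by
    have := continuous_energy.measurable
    refine Measurable.mul (Measurable.ennreal_ofReal (by fun_prop)) (hF.comp ?_)
    unfold boost
    fun_prop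
  rw [lintegral_eq_of_measurePreserving_prod hP hF, lintegral_eq_of_measurePreserving_prod hP hm0]
  refine lintegral_congr fun t => ?_
  have hmono : Monotone (fun l : ℝ => l * (√(1 + ‖t‖ ^ 2 + l ^ 2 + ‖c‖ ^ 2) /
      √(1 + ‖t‖ ^ 2 + l ^ 2))) :=
    monotone_of_deriv_nonneg (fun l => (hasDerivAt_boost_axis (hτ t) hκ l).differentiableAt)
      fun l => by
        rw [(hasDerivAt_boost_axis (hτ t) hκ l).deriv]
        exact boost_axis_deriv_nonneg (hτ t) hκ l
  rw [lintegral_comp_mul_deriv_of_surjective (hasDerivAt_boost_axis (hτ t) hκ) hmono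
    (boost_axis_surjective (hτ t) hκ)]
  refine lintegral_congr fun l => ?_
  rw [hB, hin, hE, hEn, div_pow, mul_pow]

/-! ### Two-particle kinematics at fixed total four-momentum. -/

/-- Half of the total momentum. -/
noncomputable def meanMomentum (v : FourVector) : Momentum := (1 / 2 : ℝ) • spatial v

/-- The momentum, in the centre-of-momentum frame, of two particles with total four-momentum `v`
(and `0` if there are none). -/
noncomputable def cmMomentum (v : FourVector) : ℝ :=
  √((v 0 / 2 - energy (meanMomentum v)) * (|v 0 / 2| + energy (meanMomentum v)))

/-- The energy corresponding to `cmMomentum`. -/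
noncomputable def cmEnergy (v : FourVector) : ℝ := √(1 + cmMomentum v ^ 2)

/-- The momenta of two particles with total four-momentum `v` flying apart in the direction `ω`
of the centre-of-momentum frame. -/
noncomputable def collisionPair (v : FourVector) (ω : Metric.sphere (0 : Momentum) 1) :
    Momentum × Momentum :=
  (meanMomentum v + boost (cmEnergy v) |v 0 / 2| (meanMomentum v) (cmMomentum v • (ω : Momentum)),
    meanMomentum v - boost (cmEnergy v) |v 0 / 2| (meanMomentum v) (cmMomentum v • (ω : Momentum)))

/-- The density with respect to the direction `ω` of the measure on the pairs of particles with
total four-momentum `v`. -/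
noncomputable def collisionDensity (v : FourVector) (ω : Metric.sphere (0 : Momentum) 1) : ℝ :=
  cmMomentum v * ((v 0 / 2) ^ 2 -
    (inner ℝ (meanMomentum v) (cmMomentum v • (ω : Momentum)) / cmEnergy v) ^ 2) / (2 * cmEnergy v)

section Basic

variable {v : FourVector}

theorem cmMomentum_nonneg (v : FourVector) : 0 ≤ cmMomentum v := Real.sqrt_nonneg _

theorem cmEnergy_sq (v : FourVector) : cmEnergy v ^ 2 = 1 + cmMomentum v ^ 2 :=
  Real.sq_sqrt (by positivity)

theorem cmEnergy_pos (v : FourVector) : 0 < cmEnergy v := Real.sqrt_pos.2 (by positivity)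

/-- The absolute value keeps the second factor positive, so below the threshold, also for negative
`v 0`, the radicand is non-positive and the root is `0`. Such `v` then carry no mass, and no case
distinction harms continuity. -/
theorem cmMomentum_eq_zero (h : v 0 / 2 ≤ energy (meanMomentum v)) : cmMomentum v = 0 := by
  refine Real.sqrt_eq_zero_of_nonpos (mul_nonpos_of_nonpos_of_nonneg (by linarith) ?_)
  have := energy_pos (meanMomentum v)
  positivity

theorem energy_meanMomentum_lt (h : cmMomentum v ≠ 0) : energy (meanMomentum v) < v 0 / 2 := by
  by_contra hv
  exact h (cmMomentum_eq_zero (not_lt.1 hv))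

theorem time_pos (h : cmMomentum v ≠ 0) : 0 < v 0 / 2 :=
  (energy_pos _).trans (energy_meanMomentum_lt h)

theorem cmMomentum_sq (h : cmMomentum v ≠ 0) :
    cmMomentum v ^ 2 = (v 0 / 2) ^ 2 - energy (meanMomentum v) ^ 2 := by
  have h1 := energy_meanMomentum_lt h
  have h2 := energy_pos (meanMomentum v)
  rw [cmMomentum, Real.sq_sqrt (mul_nonneg (by linarith) (by positivity)),
    abs_of_pos (time_pos h)]
  ring

theorem time_sq (h : cmMomentum v ≠ 0) :
    (v 0 / 2) ^ 2 = cmEnergy v ^ 2 + ‖meanMomentum v‖ ^ 2 := by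
  rw [cmEnergy_sq, cmMomentum_sq h, energy_sq]
  ring

theorem norm_cmMomentum_smul_sq (v : FourVector) (ω : Metric.sphere (0 : Momentum) 1) :
    ‖cmMomentum v • (ω : Momentum)‖ ^ 2 = cmMomentum v ^ 2 := by
  simp [norm_smul]

theorem energy_collisionPair_fst (h : cmMomentum v ≠ 0) (ω : Metric.sphere (0 : Momentum) 1) :
    energy (collisionPair v ω).1 = v 0 / 2 +
      inner ℝ (meanMomentum v) (cmMomentum v • (ω : Momentum)) / cmEnergy v := by
  rw [collisionPair, abs_of_pos (time_pos h)]
  exact energy_add_boost (cmEnergy_pos v) (by rw [norm_cmMomentum_smul_sq, cmEnergy_sq])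
    (time_pos h) (time_sq h)

theorem energy_collisionPair_snd (h : cmMomentum v ≠ 0) (ω : Metric.sphere (0 : Momentum) 1) :
    energy (collisionPair v ω).2 = v 0 / 2 -
      inner ℝ (meanMomentum v) (cmMomentum v • (ω : Momentum)) / cmEnergy v := by
  rw [collisionPair, abs_of_pos (time_pos h)]
  exact energy_sub_boost (cmEnergy_pos v) (by rw [norm_cmMomentum_smul_sq, cmEnergy_sq])
    (time_pos h) (time_sq h)

/-- The difference of squares factors into the energies `E ± c·y / m` of the two particles, which
cancel the factors `1/p⁰`, `1/q⁰` of the gain term. -/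
theorem collisionDensity_eq (v : FourVector) (ω : Metric.sphere (0 : Momentum) 1) :
    collisionDensity v ω = cmMomentum v *
      (energy (collisionPair v ω).1 * energy (collisionPair v ω).2) / (2 * cmEnergy v) := by
  by_cases h : cmMomentum v = 0
  · simp [collisionDensity, h]
  · rw [energy_collisionPair_fst h, energy_collisionPair_snd h, collisionDensity]
    ring

theorem collisionDensity_nonneg (v : FourVector) (ω : Metric.sphere (0 : Momentum) 1) :
    0 ≤ collisionDensity v ω := by
  rw [collisionDensity_eq]
  have h1 := cmMomentum_nonneg v
  have h2 := cmEnergy_pos v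
  have h3 := energy_pos (collisionPair v ω).1
  have h4 := energy_pos (collisionPair v ω).2
  positivity

theorem cmEnergy_sq_le (h : cmMomentum v ≠ 0) (ω : Metric.sphere (0 : Momentum) 1) :
    cmEnergy v ^ 2 ≤ energy (collisionPair v ω).1 * energy (collisionPair v ω).2 := by
  rw [energy_collisionPair_fst h, energy_collisionPair_snd h]
  have := inner_sq_le_of_sq_eq (y := cmMomentum v • (ω : Momentum)) (meanMomentum v)
    (cmEnergy_pos v) (by rw [norm_cmMomentum_smul_sq, cmEnergy_sq])
  nlinarith [time_sq h]

theorem fourVector_ext {x y : FourVector} (h0 : x 0 = y 0) (h : spatial x = spatial y) : x = y := by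
  ext i
  refine Fin.cases h0 (fun i => ?_) i
  exact congrArg (fun p : Momentum => p i) h

theorem fourMomentum_collisionPair (h : cmMomentum v ≠ 0) (ω : Metric.sphere (0 : Momentum) 1) :
    fourMomentum (collisionPair v ω).1 + fourMomentum (collisionPair v ω).2 = v := by
  refine fourVector_ext ?_ ?_
  · rw [PiLp.add_apply, fourMomentum_zero, fourMomentum_zero, energy_collisionPair_fst h,
      energy_collisionPair_snd h]
    ring
  · rw [spatial_add, spatial_fourMomentum, spatial_fourMomentum, collisionPair, add_add_sub_cancel,
      ← two_smul ℝ, meanMomentum, smul_smul]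
    norm_num

@[fun_prop]
theorem continuous_spatial : Continuous spatial := by
  unfold spatial
  fun_prop

@[fun_prop]
theorem continuous_meanMomentum : Continuous meanMomentum := by
  unfold meanMomentum
  fun_prop

@[fun_prop]
theorem continuous_cmMomentum : Continuous cmMomentum := by
  unfold cmMomentum
  fun_prop

@[fun_prop]
theorem continuous_cmEnergy : Continuous cmEnergy := by
  unfold cmEnergy
  fun_prop

theorem continuous_collisionDensity : Continuous (Function.uncurry collisionDensity) := by
  simp only [Function.uncurry_def, collisionDensity]
  refine Continuous.div ?_ (by fun_prop) fun z => by have := cmEnergy_pos z.1; positivity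
  refine Continuous.mul (by fun_prop) (Continuous.sub (by fun_prop) (Continuous.pow ?_ 2))
  exact Continuous.div (by fun_prop) (by fun_prop) fun z => (cmEnergy_pos z.1).ne'

/-- `|v 0 / 2|` in the definition keeps the denominator positive for every `v`. -/
theorem continuous_collisionPair : Continuous (Function.uncurry collisionPair) := by
  simp only [Function.uncurry_def, collisionPair, boost]
  have : Continuous fun z : FourVector × Metric.sphere (0 : Momentum) 1 =>
      inner ℝ (meanMomentum z.1) (cmMomentum z.1 • (z.2 : Momentum)) /
        (cmEnergy z.1 * (|z.1 0 / 2| + cmEnergy z.1)) :=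
    Continuous.div (by fun_prop) (by fun_prop) fun z => by have := cmEnergy_pos z.1; positivity
  fun_prop

end Basic

/-! ### Disintegration over the total four-momentum, and the collision measure. -/

/-- Polar coordinates with the radius expressed through the total energy `w = 2 √(e² + r²)`, so that
`r² dr = (w r / 4) dw`. -/
theorem lintegral_eq_lintegral_energy_sphere {e : ℝ} (he : 0 < e) {G : Momentum → ENNReal}
    (hG : Measurable G) :
    ∫⁻ y, G y = ∫⁻ w in Set.Ioi (2 * e), ∫⁻ ω, ENNReal.ofReal (w * √((w / 2) ^ 2 - e ^ 2) / 4) *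
      G (√((w / 2) ^ 2 - e ^ 2) • (ω : Momentum)) ∂(volume : Measure Momentum).toSphere := by
  have hpos : ∀ w ∈ Set.Ioi (2 * e), 0 < (w / 2) ^ 2 - e ^ 2 := fun w hw => by
    have : 2 * e < w := hw
    nlinarith
  have hd : ∀ w ∈ Set.Ioi (2 * e), HasDerivWithinAt (fun w => √((w / 2) ^ 2 - e ^ 2))
      (w / (4 * √((w / 2) ^ 2 - e ^ 2))) (Set.Ioi (2 * e)) w := fun w hw => by
    have h1 : HasDerivAt (fun w : ℝ => (w / 2) ^ 2 - e ^ 2) (w / 2) w := by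
      refine ((((hasDerivAt_id w).div_const 2).pow 2).sub_const (e ^ 2)).congr_deriv ?_
      simp
      ring
    refine ((h1.sqrt (hpos w hw).ne').congr_deriv ?_).hasDerivWithinAt
    rw [div_div, ← mul_assoc]
    norm_num
  have hm : MonotoneOn (fun w => √((w / 2) ^ 2 - e ^ 2)) (Set.Ioi (2 * e)) :=
    fun x hx y hy hxy => by
      have hx : 2 * e < x := hx
      refine Real.sqrt_le_sqrt (sub_le_sub_right (pow_le_pow_left₀ (by linarith) (by linarith) 2) _)
  have himg : (fun w => √((w / 2) ^ 2 - e ^ 2)) '' Set.Ioi (2 * e) = Set.Ioi 0 := by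
    ext r
    constructor
    · rintro ⟨w, hw, rfl⟩
      exact Real.sqrt_pos.2 (hpos w hw)
    · intro hr
      have hr : 0 < r := hr
      refine ⟨2 * √(e ^ 2 + r ^ 2), ?_, ?_⟩
      · have : e < √(e ^ 2 + r ^ 2) := Real.lt_sqrt_of_sq_lt (by nlinarith)
        show 2 * e < 2 * √(e ^ 2 + r ^ 2)
        linarith
      · dsimp only
        rw [mul_div_cancel_left₀ _ two_ne_zero, Real.sq_sqrt (by positivity), add_sub_cancel_left,
          Real.sqrt_sq hr.le]
  rw [lintegral_eq_lintegral_sphere volume hG, lintegral_lintegral_swap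
    (f := fun (w : ℝ) (ω : Metric.sphere (0 : Momentum) 1) =>
      ENNReal.ofReal (w * √((w / 2) ^ 2 - e ^ 2) / 4) *
      G (√((w / 2) ^ 2 - e ^ 2) • (ω : Momentum))) (Measurable.aemeasurable
        (Measurable.mul (by fun_prop) (hG.comp (by fun_prop))))]
  refine lintegral_congr fun ω => ?_
  rw [← himg, lintegral_image_eq_lintegral_deriv_mul_of_monotoneOn measurableSet_Ioi hd hm]
  refine setLIntegral_congr_fun measurableSet_Ioi fun w hw => ?_
  have hs := Real.sqrt_pos.2 (hpos w hw)
  have hw : 2 * e < w := hw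
  rw [← mul_assoc, ← ENNReal.ofReal_mul (div_nonneg (by linarith) (by positivity))]
  congr 2
  simp only [finrank_euclideanSpace, Fintype.card_fin]
  norm_num
  field_simp

theorem lintegral_prod_eq_lintegral_mean {F : Momentum × Momentum → ENNReal} (hF : Measurable F) :
    ∫⁻ z, F z = ∫⁻ P : Momentum, ∫⁻ x : Momentum,
      F ((1 / 2 : ℝ) • P + x, (1 / 2 : ℝ) • P - x) := by
  rw [show (volume : Measure (Momentum × Momentum)) = volume.prod volume from rfl,
    lintegral_prod _ hF.aemeasurable]
  calc ∫⁻ p, ∫⁻ q, F (p, q) = ∫⁻ p : Momentum, ∫⁻ P : Momentum, F (p, P - p) :=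
        lintegral_congr fun p => (lintegral_sub_right_eq_self (fun q => F (p, q)) p).symm
    _ = ∫⁻ P : Momentum, ∫⁻ p : Momentum, F (p, P - p) :=
        lintegral_lintegral_swap (Measurable.aemeasurable (hF.comp (by fun_prop)))
    _ = _ := by
        refine lintegral_congr fun P => ?_
        rw [← lintegral_add_left_eq_self _ ((1 / 2 : ℝ) • P)]
        refine lintegral_congr fun x => ?_
        congr 2
        rw [← sub_sub]
        congr 1
        rw [sub_eq_iff_eq_add, ← two_smul ℝ, smul_smul]
        norm_num

/-- Disintegration of the volume on pairs of momenta over the total four-momentum. -/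
theorem lintegral_eq_lintegral_collisionPair {F : Momentum × Momentum → ENNReal}
    (hF : Measurable F) :
    ∫⁻ z, F z = ∫⁻ v, ∫⁻ ω, ENNReal.ofReal (collisionDensity v ω) * F (collisionPair v ω)
      ∂(volume : Measure Momentum).toSphere := by
  have hK : Measurable fun v => ∫⁻ ω, ENNReal.ofReal (collisionDensity v ω) *
      F (collisionPair v ω) ∂(volume : Measure Momentum).toSphere :=
    Measurable.lintegral_prod_right' (f := fun z : FourVector × Metric.sphere (0 : Momentum) 1 =>
      ENNReal.ofReal (collisionDensity z.1 z.2) * F (collisionPair z.1 z.2))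
      (continuous_collisionDensity.measurable.ennreal_ofReal.mul
        (hF.comp continuous_collisionPair.measurable))
  rw [lintegral_prod_eq_lintegral_mean hF,
    lintegral_eq_of_measurePreserving_prod (measurePreserving_euclideanCons 3) hK]
  refine lintegral_congr fun P => ?_
  set c : Momentum := (1 / 2 : ℝ) • P with hc
  have hFc : Measurable fun x => F (c + x, c - x) := hF.comp (by fun_prop)
  have hm0 : Measurable fun y : Momentum => ENNReal.ofReal ((√(1 + ‖y‖ ^ 2 + ‖c‖ ^ 2) ^ 2 -
      (inner ℝ c y / energy y) ^ 2) / (√(1 + ‖y‖ ^ 2 + ‖c‖ ^ 2) * energy y)) *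
      F (c + boost (energy y) √(1 + ‖y‖ ^ 2 + ‖c‖ ^ 2) c y,
        c - boost (energy y) √(1 + ‖y‖ ^ 2 + ‖c‖ ^ 2) c y) := by
    have := continuous_energy.measurable
    refine Measurable.mul (Measurable.ennreal_ofReal (by fun_prop)) (hFc.comp ?_)
    unfold boost
    fun_prop
  rw [lintegral_eq_lintegral_boost c hFc, lintegral_eq_lintegral_energy_sphere (energy_pos c) hm0,
    ← lintegral_indicator measurableSet_Ioi]
  refine lintegral_congr fun w => ?_
  set v := euclideanCons 3 (w, P) with hv
  have hv0 : v 0 = w := rfl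
  have hvc : meanMomentum v = c := rfl
  by_cases hw : w ∈ Set.Ioi (2 * energy c)
  swap
  · have hρ : cmMomentum v = 0 := by
      refine cmMomentum_eq_zero ?_
      have : w ≤ 2 * energy c := not_lt.1 hw
      rw [hv0, hvc]
      linarith
    rw [Set.indicator_of_notMem hw]
    simp [collisionDensity, hρ]
  rw [Set.indicator_of_mem hw]
  have hw' : 2 * energy c < w := hw
  have he := energy_pos c
  have hρ : √((w / 2) ^ 2 - energy c ^ 2) = cmMomentum v := by
    rw [cmMomentum, hv0, hvc, abs_of_pos (by linarith)]
    congr 1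
    ring
  have hρ0 : cmMomentum v ≠ 0 := by
    rw [← hρ]
    exact (Real.sqrt_pos.2 (by nlinarith)).ne'
  rw [hρ]
  refine lintegral_congr fun ω => ?_
  have hy := norm_cmMomentum_smul_sq v ω
  have hm : energy (cmMomentum v • (ω : Momentum)) = cmEnergy v := by rw [energy, hy, cmEnergy]
  have hE : √(1 + cmMomentum v ^ 2 + ‖c‖ ^ 2) = w / 2 := by
    rw [← cmEnergy_sq, ← hvc, ← time_sq hρ0, hv0, Real.sqrt_sq (by linarith)]
  have hcp : collisionPair v ω = (c + boost (cmEnergy v) (w / 2) c (cmMomentum v • (ω : Momentum)),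
      c - boost (cmEnergy v) (w / 2) c (cmMomentum v • (ω : Momentum))) := by
    rw [collisionPair, hvc, hv0, abs_of_pos (by linarith)]
  rw [hm, hy, hE, hcp, ← mul_assoc, ← ENNReal.ofReal_mul
    (div_nonneg (mul_nonneg (by linarith) (cmMomentum_nonneg v)) (by norm_num)), collisionDensity,
    hv0, hvc]
  -- The Jacobians combine to `(w ρ / 4) · p⁰ q⁰ / ((w / 2) m) = ρ p⁰ q⁰ / (2m)`.
  congr 2
  have := cmEnergy_pos v
  have hw0 : w ≠ 0 := by linarith
  field_simp
  norm_num

/-- The measure on the pairs of particles with total four-momentum `v`. -/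
noncomputable def pairMeasure (v : FourVector) : Measure (Momentum × Momentum) :=
  ((volume : Measure Momentum).toSphere.withDensity
    fun ω => ENNReal.ofReal (collisionDensity v ω)).map (collisionPair v)

theorem continuous_collisionDensity_right (v : FourVector) : Continuous (collisionDensity v) :=
  continuous_collisionDensity.comp (Continuous.prodMk_right v)

theorem continuous_collisionPair_right (v : FourVector) : Continuous (collisionPair v) :=
  continuous_collisionPair.comp (Continuous.prodMk_right v)

theorem continuous_collisionPair_left (ω : Metric.sphere (0 : Momentum) 1) :
    Continuous fun v => collisionPair v ω :=
  continuous_collisionPair.comp (Continuous.prodMk_left ω)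

theorem lintegral_pairMeasure (v : FourVector) {F : Momentum × Momentum → ENNReal}
    (hF : Measurable F) :
    ∫⁻ z, F z ∂(pairMeasure v) = ∫⁻ ω, ENNReal.ofReal (collisionDensity v ω) *
      F (collisionPair v ω) ∂(volume : Measure Momentum).toSphere :=
  lintegral_map_withDensity _ (continuous_collisionDensity_right v).measurable.ennreal_ofReal
    (continuous_collisionPair_right v).measurable hF

instance isFiniteMeasure_pairMeasure (v : FourVector) : IsFiniteMeasure (pairMeasure v) := by
  refine ⟨?_⟩
  rw [← lintegral_one, lintegral_pairMeasure v measurable_const]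
  simp_rw [mul_one]
  exact ((continuous_collisionDensity_right v).integrable_of_hasCompactSupport
    (HasCompactSupport.of_compactSpace _)).lintegral_lt_top

theorem continuousAt_lintegral_pairMeasure {φ : Momentum × Momentum → ℝ} (hφ : Continuous φ)
    (v : FourVector) :
    ContinuousAt (fun v => ∫⁻ z, ENNReal.ofReal (φ z) ∂(pairMeasure v)) v := by
  have hm : Measurable fun z => ENNReal.ofReal (φ z) := hφ.measurable.ennreal_ofReal
  simp_rw [lintegral_pairMeasure _ hm]
  have hc : Continuous fun z : FourVector × Metric.sphere (0 : Momentum) 1 =>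
      collisionDensity z.1 z.2 * φ (collisionPair z.1 z.2) :=
    continuous_collisionDensity.mul (hφ.comp continuous_collisionPair)
  obtain ⟨C, hC⟩ := ((isCompact_closedBall v 1).prod isCompact_univ).bddAbove_image hc.continuousOn
  refine tendsto_lintegral_filter_of_dominated_convergence (fun _ => ENNReal.ofReal C) ?_ ?_ ?_ ?_
  · exact .of_forall fun v => (continuous_collisionDensity_right v).measurable.ennreal_ofReal.mul
      (hm.comp (continuous_collisionPair_right v).measurable)
  · filter_upwards [Metric.closedBall_mem_nhds v one_pos] with w hw
    refine .of_forall fun ω => ?_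
    rw [← ENNReal.ofReal_mul (collisionDensity_nonneg _ _)]
    exact ENNReal.ofReal_le_ofReal (hC ⟨(w, ω), ⟨hw, Set.mem_univ _⟩, rfl⟩)
  · rw [lintegral_const]
    exact (ENNReal.mul_lt_top ENNReal.ofReal_lt_top (measure_lt_top _ _)).ne
  · refine .of_forall fun ω => ?_
    simp_rw [← ENNReal.ofReal_mul (collisionDensity_nonneg _ _)]
    exact (ENNReal.continuous_ofReal.comp (hc.comp (Continuous.prodMk_left ω))).tendsto v

@[fun_prop]
theorem continuous_fourMomentum : Continuous fourMomentum :=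
  (continuous_euclideanCons 3).comp (continuous_energy.prodMk continuous_id)

theorem continuous_conservationDefect (p q : Momentum) : Continuous (conservationDefect p q) := by
  unfold conservationDefect
  fun_prop

/-- A function of the total four-momentum is constant on each fibre and factors out. It serves with
the indicator of a ball to identify the Dirac measure, and with the sphere integral of the gain term
to separate it from the layer. -/
theorem lintegral_total_mul {F : Momentum × Momentum → ENNReal} (hF : Measurable F)
    {G : FourVector → ENNReal} (hG : Measurable G) :
    ∫⁻ z, G (fourMomentum z.1 + fourMomentum z.2) * F z =
      ∫⁻ v, G v * ∫⁻ z, F z ∂(pairMeasure v) := by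
  rw [lintegral_eq_lintegral_collisionPair
    (F := fun z => G (fourMomentum z.1 + fourMomentum z.2) * F z) ((hG.comp (by fun_prop)).mul hF)]
  refine lintegral_congr fun v => ?_
  have hm : Measurable fun ω => ENNReal.ofReal (collisionDensity v ω) * F (collisionPair v ω) :=
    (continuous_collisionDensity_right v).measurable.ennreal_ofReal.mul
      (hF.comp (continuous_collisionPair_right v).measurable)
  rw [lintegral_pairMeasure v hF, ← lintegral_const_mul _ hm]
  refine lintegral_congr fun ω => ?_
  by_cases h : cmMomentum v = 0
  · simp [collisionDensity, h]
  · rw [fourMomentum_collisionPair h]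
    ring

theorem isDiracPullback_pairMeasure (p q : Momentum) :
    IsDiracPullback (conservationDefect p q) (pairMeasure (fourMomentum p + fourMomentum q)) := by
  set P := fourMomentum p + fourMomentum q with hP
  -- The pairs with defect `y` are those with total four-momentum `P - y`.
  have key := isDiracPullback_of_disintegration (Φ := conservationDefect p q)
    (ν := fun y => pairMeasure (P - y)) inferInstance (fun F hF ε => ?_) (fun φ hφ _ => ?_)
  · simpa using key
  · have hB : MeasurableSet (Metric.ball (0 : FourVector) ε) := Metric.isOpen_ball.measurableSet
    have hind : Measurable fun v : FourVector =>
        (Metric.ball (0 : FourVector) ε).indicator (1 : FourVector → ENNReal) (P - v) :=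
      (measurable_one.indicator hB).comp (by fun_prop)
    have h1 := lintegral_total_mul hF hind
    rw [← lintegral_indicator (hB.preimage (continuous_conservationDefect p q).measurable),
      ← lintegral_indicator hB]
    rw [← lintegral_sub_left_eq_self _ P] at h1
    convert h1 using 1
    · refine lintegral_congr fun z => ?_
      have hz : P - (fourMomentum z.1 + fourMomentum z.2) = conservationDefect p q z := by
        rw [conservationDefect, sub_add_eq_sub_sub]
      rw [hz]
      by_cases hp : conservationDefect p q z ∈ Metric.ball 0 ε
      · rw [Set.indicator_of_mem (show z ∈ conservationDefect p q ⁻¹' Metric.ball 0 ε from hp),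
          Set.indicator_of_mem hp]
        simp
      · rw [Set.indicator_of_notMem (show z ∉ conservationDefect p q ⁻¹' Metric.ball 0 ε from hp),
          Set.indicator_of_notMem hp, zero_mul]
    · refine lintegral_congr fun y => ?_
      rw [sub_sub_cancel]
      by_cases hy : y ∈ Metric.ball 0 ε
      · rw [Set.indicator_of_mem hy, Set.indicator_of_mem hy]
        simp
      · rw [Set.indicator_of_notMem hy, Set.indicator_of_notMem hy, zero_mul]
  · have h2 := continuousAt_lintegral_pairMeasure hφ (P - 0)
    exact ContinuousAt.comp (f := fun y => P - y) (x := (0 : FourVector)) h2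
      (by fun_prop : Continuous fun y => P - y).continuousAt

theorem collisionMeasure_eq (p q : Momentum) :
    collisionMeasure p q = pairMeasure (fourMomentum p + fourMomentum q) :=
  (isDiracPullback_pairMeasure p q).eq_diracPullback

/-! ### The invariants `g` and `s` in the centre-of-momentum frame. -/

section Invariants

theorem lorentz_sub_self (p q : Momentum) :
    lorentz (fourMomentum p - fourMomentum q) (fourMomentum p - fourMomentum q) =
      2 * (energy p * energy q - 1 - inner ℝ p q) := by
  rw [lorentz_eq, real_inner_self_eq_norm_sq, spatial_sub, spatial_fourMomentum,
    spatial_fourMomentum, @norm_sub_sq_real, PiLp.sub_apply, fourMomentum_zero, fourMomentum_zero]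
  linear_combination -energy_sq p - energy_sq q

/-- `(1 + ‖p‖²)(1 + ‖q‖²) - (1 + p·q)²` equals `‖p - q‖²` plus the Cauchy–Schwarz defect of `p` and
`q`. -/
theorem lorentz_sub_self_pos {p q : Momentum} (h : p ≠ q) :
    0 < lorentz (fourMomentum p - fourMomentum q) (fourMomentum p - fourMomentum q) := by
  rw [lorentz_sub_self]
  have h1 : 0 < ‖p - q‖ ^ 2 := by
    have := norm_pos_iff.2 (sub_ne_zero.2 h)
    positivity
  rw [@norm_sub_sq_real] at h1
  have h2 : inner ℝ p q ^ 2 ≤ (‖p‖ * ‖q‖) ^ 2 := by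
    rw [← sq_abs]
    exact pow_le_pow_left₀ (abs_nonneg _) (abs_real_inner_le_norm p q) 2
  have h3 : 1 + inner ℝ p q < energy p * energy q := by
    refine lt_of_pow_lt_pow_left₀ 2 (mul_pos (energy_pos p) (energy_pos q)).le ?_
    rw [mul_pow, energy_sq, energy_sq]
    nlinarith
  linarith

/-- In the centre-of-momentum frame `p^μ - q^μ` is `(0, 2y)` with `‖y‖ = ρ`; likewise `p^μ + q^μ` is
`(2m, 0)`, so `s = 4m²`. -/
theorem gRel_eq (p q : Momentum) :
    gRel p q = 2 * cmMomentum (fourMomentum p + fourMomentum q) := by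
  have h1 : 0 < (fourMomentum p + fourMomentum q) 0 / 2 := by
    have := energy_pos p
    have := energy_pos q
    rw [PiLp.add_apply, fourMomentum_zero, fourMomentum_zero]
    positivity
  have h2 : energy (meanMomentum (fourMomentum p + fourMomentum q)) ^ 2 =
      1 + 1 / 4 * ‖p + q‖ ^ 2 := by
    rw [energy_sq, meanMomentum, norm_smul, mul_pow, spatial_add]
    norm_num
  rw [gRel, lorentz_sub_self, cmMomentum, abs_of_pos h1,
    show (2 : ℝ) = √(2 ^ 2) by rw [Real.sqrt_sq zero_le_two], ← Real.sqrt_mul (by norm_num)]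
  congr 1
  rw [Real.sqrt_sq zero_le_two]
  rw [@norm_add_sq_real] at h2
  rw [PiLp.add_apply, fourMomentum_zero, fourMomentum_zero]
  linear_combination 4 * h2 - energy_sq p - energy_sq q

theorem sInv_eq {p q : Momentum} (h : p ≠ q) :
    sInv p q = 4 * cmEnergy (fourMomentum p + fourMomentum q) ^ 2 := by
  have h1 : (2 * cmMomentum (fourMomentum p + fourMomentum q)) ^ 2 =
      2 * (energy p * energy q - 1 - inner ℝ p q) := by
    rw [← gRel_eq, gRel, Real.sq_sqrt (lorentz_sub_self_pos h).le, lorentz_sub_self]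
  rw [cmEnergy_sq, sInv, lorentz_eq, real_inner_self_eq_norm_sq, spatial_add, spatial_fourMomentum,
    spatial_fourMomentum, @norm_add_sq_real, PiLp.add_apply, fourMomentum_zero, fourMomentum_zero]
  linear_combination energy_sq p + energy_sq q - h1

end Invariants

/-! ### The layer about the hypersurface as a zone of the collision sphere. -/

section Zone

variable {v : FourVector} {a : FourVector}

/-- The spatial part of `a` in the centre-of-momentum frame of `v`. -/
noncomputable def cmSpatial (v a : FourVector) : Momentum :=
  spatial a + (inner ℝ (spatial a) (meanMomentum v) / (cmEnergy v * (v 0 / 2 + cmEnergy v)) -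
    a 0 / cmEnergy v) • meanMomentum v

/-- Lorentz invariance: `a^μ a_μ` is the squared length of the boosted spatial part minus the square
of the boosted time component, `(d - a⁰ E) / m` up to sign, which is dropped. -/
theorem lorentz_le_norm_cmSpatial_sq (h : cmMomentum v ≠ 0) :
    lorentz a a ≤ ‖cmSpatial v a‖ ^ 2 := by
  have hm := cmEnergy_pos v
  have hE := time_pos h
  have hc : ‖meanMomentum v‖ ^ 2 = (v 0 / 2) ^ 2 - cmEnergy v ^ 2 := by rw [time_sq h]; ring
  have hEm : v 0 / 2 + cmEnergy v ≠ 0 := by positivity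
  rw [lorentz_self_eq, cmSpatial, @norm_add_sq_real, norm_smul, mul_pow,
    Real.norm_eq_abs, sq_abs, inner_smul_right, hc]
  set d := inner ℝ (spatial a) (meanMomentum v)
  set m := cmEnergy v
  set E := v 0 / 2
  have key : ‖spatial a‖ ^ 2 + 2 * ((d / (m * (E + m)) - a 0 / m) * d) +
      (d / (m * (E + m)) - a 0 / m) ^ 2 * (E ^ 2 - m ^ 2) =
      ‖spatial a‖ ^ 2 - a 0 ^ 2 + ((d - a 0 * E) / m) ^ 2 := by
    field_simp
    ring
  rw [key]
  exact le_add_of_nonneg_right (sq_nonneg _)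

/-- On the sphere both the momentum and the energy of a particle are affine in `ω`, hence so is this
function, and its small values fill a zone. -/
theorem hyperplaneFun_collisionPair (h : cmMomentum v ≠ 0) (a b : FourVector)
    (ω : Metric.sphere (0 : Momentum) 1) :
    hyperplaneFun a b (collisionPair v ω).1 =
      (inner ℝ (spatial a) (meanMomentum v) - a 0 * (v 0 / 2) - lorentz a b) +
        inner ℝ (cmMomentum v • cmSpatial v a) (ω : Momentum) := by
  have hm := cmEnergy_pos v
  have hE := time_pos h
  rw [hyperplaneFun_eq, energy_collisionPair_fst h, collisionPair, abs_of_pos hE, boost, cmSpatial]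
  simp only [inner_add_right, inner_add_left, inner_smul_left, inner_smul_right]
  simp only [conj_trivial]
  have hEm : v 0 / 2 + cmEnergy v ≠ 0 := by positivity
  field_simp
  ring

theorem toSphere_hyperplane_le (h : cmMomentum v ≠ 0) (ha : IsSpaceLike a) (b : FourVector) {ε : ℝ}
    (hε : 0 < ε) :
    (volume : Measure Momentum).toSphere
      {ω | |hyperplaneFun a b (collisionPair v ω).1| < ε} ≤
      ENNReal.ofReal (12 * Real.pi * (ε / (cmMomentum v * √(lorentz a a)))) := by
  have hρ : 0 < cmMomentum v := (cmMomentum_nonneg v).lt_of_ne' h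
  have ha' : 0 < √(lorentz a a) := Real.sqrt_pos.2 ha
  have hu : √(lorentz a a) ≤ ‖cmSpatial v a‖ :=
    Real.sqrt_le_iff.2 ⟨norm_nonneg _, lorentz_le_norm_cmSpatial_sq h⟩
  have hu0 : cmSpatial v a ≠ 0 := norm_pos_iff.1 (ha'.trans_le hu)
  simp_rw [hyperplaneFun_collisionPair h]
  refine (toSphere_zone_le _ (smul_ne_zero h hu0) _ _ hε).trans (ENNReal.ofReal_le_ofReal ?_)
  rw [norm_smul, Real.norm_eq_abs, abs_of_pos hρ]
  gcongr

end Zone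

/-! ### The gain term integrated over a layer. -/

/-- The integral over the collision sphere in the gain term for the cross section `σ = c g`. -/
noncomputable def sphereGain (c : ℝ) (F : Momentum → ENNReal) (v : FourVector) : ENNReal :=
  ∫⁻ ω, ENNReal.ofReal (2 * c * cmMomentum v ^ 2 * cmEnergy v) *
    (F (collisionPair v ω).1 * F (collisionPair v ω).2) ∂(volume : Measure Momentum).toSphere

/-- The weighted gain term `√p⁰ Q⁺(F, F)(p)` for the cross section `σ = c g`. -/
noncomputable def weightedGain (c : ℝ) (F : Momentum → ENNReal) (p : Momentum) : ENNReal :=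
  ENNReal.ofReal (√(energy p) / energy p) *
    ∫⁻ q, ENNReal.ofReal (1 / energy q) * sphereGain c F (fourMomentum p + fourMomentum q)

theorem lowerSemicontinuous_sphereGain (c : ℝ) {F : Momentum → ENNReal}
    (hF : LowerSemicontinuous F) : LowerSemicontinuous (sphereGain c F) := fun v => by
  refine LowerSemicontinuousAt.lintegral_param (fun v => ?_) fun ω => ?_
  · have := (continuous_collisionPair_right v).measurable
    exact measurable_const.mul
      ((hF.measurable.comp this.fst).mul (hF.measurable.comp this.snd))
  · have := continuous_collisionPair_left ω
    refine LowerSemicontinuousAt.ennreal_mul ?_ (LowerSemicontinuousAt.ennreal_mul ?_ ?_)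
    · exact (ENNReal.continuous_ofReal.comp (by fun_prop)).lowerSemicontinuous v
    · exact (hF.comp this.fst) v
    · exact (hF.comp this.snd) v

theorem lowerSemicontinuous_weightedGain (c : ℝ) {F : Momentum → ENNReal}
    (hF : LowerSemicontinuous F) : LowerSemicontinuous (weightedGain c F) := fun p => by
  have hK := lowerSemicontinuous_sphereGain c hF
  refine LowerSemicontinuousAt.ennreal_mul ?_
    (LowerSemicontinuousAt.lintegral_param (fun p => ?_) fun q => ?_)
  · refine (ENNReal.continuous_ofReal.comp ?_).lowerSemicontinuous p
    exact Continuous.div (by fun_prop) (by fun_prop) fun p => (energy_pos p).ne'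
  · have := continuous_energy.measurable
    exact Measurable.mul (by fun_prop) (hK.measurable.comp (by fun_prop))
  · refine LowerSemicontinuousAt.ennreal_mul (continuous_const.lowerSemicontinuous p) ?_
    exact (hK.comp (by fun_prop : Continuous fun p => fourMomentum p + fourMomentum q)) p

/-- The bound must hold at every `p`, as the hypersurface is a null set. From `σ ≤ c₂ g` one gets `s
σ / 2 ≤ 4 c₂ ρ m²`, and the factor `ρ / (2m)` of the density leaves `2 c₂ ρ² m`. -/
theorem gain_le_weightedGain {c₁ c₂ : ℝ} {σ : ℝ → ℝ → ℝ} (hσ : IsHardBall c₁ c₂ σ)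
    {f : Momentum → ℝ} (hf : ∀ p, 0 ≤ f p) {F : Momentum → ENNReal} (hF : Measurable F)
    (hfF : ∀ p, ENNReal.ofReal (f p) ≤ F p) (p : Momentum) :
    ENNReal.ofReal (√(energy p)) * gain σ f f p ≤ weightedGain c₂ F p := by
  rw [gain, weightedGain, ← mul_assoc, ← ENNReal.ofReal_mul (Real.sqrt_nonneg _), mul_one_div]
  refine mul_le_mul_right (lintegral_mono_ae ?_) _
  -- At `q = p` one has `g = 0`, where `σ` is not controlled; this is a single point of the
  -- `q`-space.
  filter_upwards [compl_mem_ae_iff.2 (measure_singleton p)] with q hq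
  have hpq : p ≠ q := fun h => hq h.symm
  refine mul_le_mul_right ?_ _
  set v := fourMomentum p + fourMomentum q with hv
  have hg : 0 < gRel p q := Real.sqrt_pos.2 (lorentz_sub_self_pos hpq)
  have hρ : 0 < cmMomentum v := by
    have := gRel_eq p q
    linarith
  have hm := cmEnergy_pos v
  calc _ ≤ ∫⁻ z, ENNReal.ofReal (1 / (energy z.1 * energy z.2) *
        (4 * c₂ * cmMomentum v * cmEnergy v ^ 2)) * (F z.1 * F z.2) ∂(collisionMeasure p q) := by
        refine lintegral_mono fun z => ?_
        have h1 := hσ.2 (gRel p q) (scatteringAngle p q z.1 z.2) hg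
          ⟨Real.arccos_nonneg _, Real.arccos_le_pi _⟩
        have he1 := energy_pos z.1
        have he2 := energy_pos z.2
        have h0 : 0 ≤ f z.1 * f z.2 := mul_nonneg (hf _) (hf _)
        rw [ENNReal.ofReal_mul' h0, ENNReal.ofReal_mul (hf _)]
        refine mul_le_mul' (ENNReal.ofReal_le_ofReal ?_) (mul_le_mul' (hfF _) (hfF _))
        rw [sInv_eq hpq]
        refine mul_le_mul_of_nonneg_left ?_ (by positivity)
        have h2 := h1.2
        rw [gRel_eq] at h2 ⊢
        calc 1 / 2 * (4 * cmEnergy v ^ 2) * σ (2 * cmMomentum v) (scatteringAngle p q z.1 z.2)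
            ≤ 1 / 2 * (4 * cmEnergy v ^ 2) * (c₂ * (2 * cmMomentum v)) := by gcongr
          _ = _ := by ring
    _ = sphereGain c₂ F v := by
        rw [collisionMeasure_eq, ← hv, lintegral_pairMeasure]
        · refine lintegral_congr fun ω => ?_
          rw [← mul_assoc, ← ENNReal.ofReal_mul (collisionDensity_nonneg _ _), collisionDensity_eq]
          congr 2
          have he1 := energy_pos (collisionPair v ω).1
          have he2 := energy_pos (collisionPair v ω).2
          field_simp
          norm_num
        · have := continuous_energy.measurable
          exact Measurable.mul (by fun_prop) ((hF.comp measurable_fst).mul (hF.comp measurable_snd))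

theorem sqrt_add_le_of_one_le {x y : ℝ} (hx : 1 ≤ x) (hy : 1 ≤ y) : √(x + y) ≤ 2 * (√x * √y) := by
  rw [← Real.sqrt_mul (by linarith), Real.sqrt_le_iff, mul_pow, Real.sq_sqrt (by positivity)]
  refine ⟨by positivity, ?_⟩
  nlinarith [mul_nonneg (sub_nonneg.2 hx) (sub_nonneg.2 hy)]

theorem one_le_energy (p : Momentum) : 1 ≤ energy p := by
  rw [energy, Real.one_le_sqrt]
  nlinarith [sq_nonneg ‖p‖]

/-- The measure of a layer about the hypersurface under the collision sphere measure, with the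
weights of the gain term. -/
theorem lintegral_layer_le {v a : FourVector} (h : cmMomentum v ≠ 0) (ha : IsSpaceLike a)
    (b : FourVector) {ε : ℝ} (hε : 0 < ε) :
    ∫⁻ z, (hyperplaneFun a b ⁻¹' Metric.ball 0 ε).indicator
        (fun p => ENNReal.ofReal (√(energy p) / energy p)) z.1 * ENNReal.ofReal (1 / energy z.2)
      ∂(pairMeasure v) ≤
    ENNReal.ofReal (cmMomentum v / (2 * cmEnergy v) * √(v 0) *
      (12 * Real.pi * (ε / (cmMomentum v * √(lorentz a a))))) := by
  have hB : MeasurableSet (hyperplaneFun a b ⁻¹' Metric.ball 0 ε) :=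
    Metric.isOpen_ball.measurableSet.preimage (continuous_hyperplaneFun a b).measurable
  have hen := continuous_energy.measurable
  have hmeas : Measurable fun z : Momentum × Momentum =>
      (hyperplaneFun a b ⁻¹' Metric.ball 0 ε).indicator
        (fun p => ENNReal.ofReal (√(energy p) / energy p)) z.1 * ENNReal.ofReal (1 / energy z.2) :=
    Measurable.mul (((by fun_prop : Measurable fun p : Momentum =>
      ENNReal.ofReal (√(energy p) / energy p)).indicator hB).comp measurable_fst) (by fun_prop)
  have hm := cmEnergy_pos v
  have hρ := cmMomentum_nonneg v
  set Z : Set (Metric.sphere (0 : Momentum) 1) :=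
    {ω | |hyperplaneFun a b (collisionPair v ω).1| < ε} with hZ
  have hZm : MeasurableSet Z := by
    refine measurableSet_lt (Measurable.abs ?_) measurable_const
    exact (continuous_hyperplaneFun a b).measurable.comp
      (continuous_collisionPair_right v).measurable.fst
  rw [lintegral_pairMeasure v hmeas]
  calc _ ≤ ∫⁻ ω, Z.indicator (fun _ => ENNReal.ofReal (cmMomentum v / (2 * cmEnergy v) * √(v 0))) ω
        ∂(volume : Measure Momentum).toSphere := by
        refine lintegral_mono fun ω => ?_
        by_cases hω : ω ∈ Z
        · have hω' : (collisionPair v ω).1 ∈ hyperplaneFun a b ⁻¹' Metric.ball 0 ε := by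
            rw [Set.mem_preimage, mem_ball_zero_iff]
            exact hω
          have he1 := energy_pos (collisionPair v ω).1
          have he2 := energy_pos (collisionPair v ω).2
          rw [Set.indicator_of_mem hω, Set.indicator_of_mem hω',
            ← ENNReal.ofReal_mul (by positivity), ← ENNReal.ofReal_mul (collisionDensity_nonneg _ _)]
          refine ENNReal.ofReal_le_ofReal ?_
          -- The energies in the density cancel the weights up to `√p⁰`, which is at most `√(v 0)`.
          rw [collisionDensity_eq]
          have hle : √(energy (collisionPair v ω).1) ≤ √(v 0) := by
            refine Real.sqrt_le_sqrt ?_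
            have h1 := energy_collisionPair_fst h ω
            have h2 := energy_collisionPair_snd h ω
            linarith
          calc _ = cmMomentum v / (2 * cmEnergy v) * √(energy (collisionPair v ω).1) := by
                field_simp
            _ ≤ _ := by gcongr
        · have hω' : (collisionPair v ω).1 ∉ hyperplaneFun a b ⁻¹' Metric.ball 0 ε := by
            rw [Set.mem_preimage, mem_ball_zero_iff]
            exact hω
          rw [Set.indicator_of_notMem hω, Set.indicator_of_notMem hω']
          simp
    _ ≤ _ := by
        rw [lintegral_indicator_const hZm, ENNReal.ofReal_mul
          (mul_nonneg (div_nonneg hρ (by positivity)) (Real.sqrt_nonneg _))]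
        exact mul_le_mul_right (toSphere_hyperplane_le h ha b hε) _

/-- The `1/ρ` of the zone estimate cancels, and the layer becomes a constant of order `ε` times `√(v
0)`. What is left is rewritten with the density in front, ready for the disintegration to be undone.
-/
theorem layer_mul_sphereGain_le {v a : FourVector} (ha : IsSpaceLike a) (b : FourVector)
    {c : ℝ} (hc : 0 < c) (F : Momentum → ENNReal) {ε : ℝ} (hε : 0 < ε) :
    sphereGain c F v * ∫⁻ z, (hyperplaneFun a b ⁻¹' Metric.ball 0 ε).indicator
        (fun p => ENNReal.ofReal (√(energy p) / energy p)) z.1 * ENNReal.ofReal (1 / energy z.2)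
      ∂(pairMeasure v) ≤
    ∫⁻ ω, ENNReal.ofReal (collisionDensity v ω) *
      (ENNReal.ofReal (48 * Real.pi * c * ε / √(lorentz a a)) *
        ((ENNReal.ofReal √(energy (collisionPair v ω).1) * F (collisionPair v ω).1) *
          (ENNReal.ofReal √(energy (collisionPair v ω).2) * F (collisionPair v ω).2)))
      ∂(volume : Measure Momentum).toSphere := by
  by_cases h : cmMomentum v = 0
  · simp [sphereGain, h]
  have ha' : 0 < √(lorentz a a) := Real.sqrt_pos.2 ha
  have hm := cmEnergy_pos v
  have hρ : 0 < cmMomentum v := (cmMomentum_nonneg v).lt_of_ne' h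
  refine (mul_le_mul_right (lintegral_layer_le h ha b hε) _).trans ?_
  rw [sphereGain, ← lintegral_mul_const' _ _ ENNReal.ofReal_ne_top]
  refine lintegral_mono fun ω => ?_
  have he1 := one_le_energy (collisionPair v ω).1
  have he2 := one_le_energy (collisionPair v ω).2
  have hle := cmEnergy_sq_le h ω
  have hv0 : v 0 = energy (collisionPair v ω).1 + energy (collisionPair v ω).2 := by
    rw [energy_collisionPair_fst h, energy_collisionPair_snd h]
    ring
  have hsq := sqrt_add_le_of_one_le he1 he2
  rw [← hv0] at hsq
  have hρm : cmMomentum v ≤ cmEnergy v := by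
    refine le_of_sq_le_sq ?_ hm.le
    rw [cmEnergy_sq]
    linarith
  have hreal : 2 * c * cmMomentum v ^ 2 * cmEnergy v * (cmMomentum v / (2 * cmEnergy v) * √(v 0) *
      (12 * Real.pi * (ε / (cmMomentum v * √(lorentz a a))))) ≤
      collisionDensity v ω * (48 * Real.pi * c * ε / √(lorentz a a)) *
        (√(energy (collisionPair v ω).1) * √(energy (collisionPair v ω).2)) := by
    rw [collisionDensity_eq]
    set x := energy (collisionPair v ω).1
    set y := energy (collisionPair v ω).2
    set ρ := cmMomentum v
    set m := cmEnergy v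
    -- From `ρ ≤ m` and `m² ≤ x * y`.
    have hxy : ρ * m ≤ x * y := by nlinarith
    calc _ = 12 * Real.pi * c * ε / √(lorentz a a) * (ρ / m) * ((ρ * m) * √(v 0)) := by
          field_simp
      _ ≤ 12 * Real.pi * c * ε / √(lorentz a a) * (ρ / m) * ((x * y) * (2 * (√x * √y))) := by
          gcongr
      _ = _ := by
          field_simp
          ring
  have hleft : 0 ≤ 2 * c * cmMomentum v ^ 2 * cmEnergy v := by positivity
  have hright : 0 ≤ collisionDensity v ω * (48 * Real.pi * c * ε / √(lorentz a a)) :=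
    mul_nonneg (collisionDensity_nonneg _ _) (by positivity)
  set X := F (collisionPair v ω).1
  set Y := F (collisionPair v ω).2
  set α := cmMomentum v / (2 * cmEnergy v) * √(v 0) *
      (12 * Real.pi * (ε / (cmMomentum v * √(lorentz a a))))
  calc _ = ENNReal.ofReal (2 * c * cmMomentum v ^ 2 * cmEnergy v * α) * (X * Y) := by
        rw [ENNReal.ofReal_mul hleft]
        ring
    _ ≤ ENNReal.ofReal (collisionDensity v ω * (48 * Real.pi * c * ε / √(lorentz a a)) *
        (√(energy (collisionPair v ω).1) * √(energy (collisionPair v ω).2))) * (X * Y) :=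
        mul_le_mul_left (ENNReal.ofReal_le_ofReal hreal) _
    _ = _ := by
        rw [ENNReal.ofReal_mul hright, ENNReal.ofReal_mul (collisionDensity_nonneg _ _),
          ENNReal.ofReal_mul (Real.sqrt_nonneg _)]
        ring

theorem lintegral_layer_weightedGain_le {a : FourVector} (ha : IsSpaceLike a) (b : FourVector)
    {c : ℝ} (hc : 0 < c) {F : Momentum → ENNReal} (hF : LowerSemicontinuous F) {ε : ℝ}
    (hε : 0 < ε) :
    ∫⁻ p in hyperplaneFun a b ⁻¹' Metric.ball 0 ε, weightedGain c F p ≤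
      ENNReal.ofReal (24 * Real.pi * c / √(lorentz a a)) *
        (∫⁻ p, ENNReal.ofReal √(energy p) * F p) ^ 2 * volume (Metric.ball (0 : ℝ) ε) := by
  have ha' : 0 < √(lorentz a a) := Real.sqrt_pos.2 ha
  have hB : MeasurableSet (hyperplaneFun a b ⁻¹' Metric.ball 0 ε) :=
    Metric.isOpen_ball.measurableSet.preimage (continuous_hyperplaneFun a b).measurable
  have hen := continuous_energy.measurable
  have hK := (lowerSemicontinuous_sphereGain c hF).measurable
  have hFm := hF.measurable
  have hind : Measurable ((hyperplaneFun a b ⁻¹' Metric.ball 0 ε).indicator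
      (fun p => ENNReal.ofReal (√(energy p) / energy p))) :=
    (by fun_prop : Measurable fun p : Momentum =>
      ENNReal.ofReal (√(energy p) / energy p)).indicator hB
  set I := (hyperplaneFun a b ⁻¹' Metric.ball 0 ε).indicator
      (fun p => ENNReal.ofReal (√(energy p) / energy p)) with hI
  have hW : Measurable fun z : Momentum × Momentum => I z.1 * ENNReal.ofReal (1 / energy z.2) :=
    (hind.comp measurable_fst).mul (by fun_prop)
  have hg : Measurable fun p : Momentum => ENNReal.ofReal √(energy p) * F p :=
    Measurable.mul (by fun_prop) hFm
  have hT : Measurable fun z : Momentum × Momentum =>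
      ENNReal.ofReal (48 * Real.pi * c * ε / √(lorentz a a)) *
        ((ENNReal.ofReal √(energy z.1) * F z.1) * (ENNReal.ofReal √(energy z.2) * F z.2)) :=
    measurable_const.mul ((hg.comp measurable_fst).mul (hg.comp measurable_snd))
  calc ∫⁻ p in hyperplaneFun a b ⁻¹' Metric.ball 0 ε, weightedGain c F p
      = ∫⁻ p, ∫⁻ q, sphereGain c F (fourMomentum p + fourMomentum q) *
          (I p * ENNReal.ofReal (1 / energy q)) := by
        rw [← lintegral_indicator hB]
        refine lintegral_congr fun p => ?_
        have hKp : Measurable fun q => ENNReal.ofReal (1 / energy q) *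
            sphereGain c F (fourMomentum p + fourMomentum q) :=
          Measurable.mul (by fun_prop) (hK.comp (by fun_prop))
        have h1 : (hyperplaneFun a b ⁻¹' Metric.ball 0 ε).indicator (weightedGain c F) p =
            I p * ∫⁻ q, ENNReal.ofReal (1 / energy q) *
              sphereGain c F (fourMomentum p + fourMomentum q) := by
          by_cases hp : p ∈ hyperplaneFun a b ⁻¹' Metric.ball 0 ε
          · rw [hI, Set.indicator_of_mem hp, Set.indicator_of_mem hp, weightedGain]
          · rw [hI, Set.indicator_of_notMem hp, Set.indicator_of_notMem hp, zero_mul]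
        rw [h1, ← lintegral_const_mul _ hKp]
        refine lintegral_congr fun q => ?_
        ring
    _ = ∫⁻ z : Momentum × Momentum, sphereGain c F (fourMomentum z.1 + fourMomentum z.2) *
          (I z.1 * ENNReal.ofReal (1 / energy z.2)) :=
        (lintegral_prod (fun z : Momentum × Momentum =>
          sphereGain c F (fourMomentum z.1 + fourMomentum z.2) *
          (I z.1 * ENNReal.ofReal (1 / energy z.2)))
          ((hK.comp (by fun_prop)).mul hW).aemeasurable).symm
    _ = ∫⁻ v, sphereGain c F v *
          ∫⁻ z, I z.1 * ENNReal.ofReal (1 / energy z.2) ∂(pairMeasure v) :=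
        lintegral_total_mul hW hK
    _ ≤ ∫⁻ v, ∫⁻ ω, ENNReal.ofReal (collisionDensity v ω) *
          (ENNReal.ofReal (48 * Real.pi * c * ε / √(lorentz a a)) *
          ((ENNReal.ofReal √(energy (collisionPair v ω).1) * F (collisionPair v ω).1) *
          (ENNReal.ofReal √(energy (collisionPair v ω).2) * F (collisionPair v ω).2)))
          ∂(volume : Measure Momentum).toSphere :=
        lintegral_mono fun v => layer_mul_sphereGain_le ha b hc F hε
    _ = ∫⁻ z : Momentum × Momentum, ENNReal.ofReal (48 * Real.pi * c * ε / √(lorentz a a)) *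
        ((ENNReal.ofReal √(energy z.1) * F z.1) * (ENNReal.ofReal √(energy z.2) * F z.2)) :=
        (lintegral_eq_lintegral_collisionPair hT).symm
    _ = ENNReal.ofReal (48 * Real.pi * c * ε / √(lorentz a a)) *
        ((∫⁻ p, ENNReal.ofReal √(energy p) * F p) * ∫⁻ p, ENNReal.ofReal √(energy p) * F p) := by
        rw [lintegral_const_mul' _ _ ENNReal.ofReal_ne_top]
        congr 1
        exact lintegral_prod_mul hg.aemeasurable hg.aemeasurable
    _ = _ := by
        -- The ball has length `2ε`, so `48π c ε` is `24π c` times its volume.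
        rw [Real.volume_ball, mul_right_comm (ENNReal.ofReal (24 * Real.pi * c / √(lorentz a a))),
          ← ENNReal.ofReal_mul (by positivity), ← pow_two]
        congr 2
        ring

/-! ### Lower semicontinuous majorants and the passage to the hypersurface. -/

/-- A lower semicontinuous majorant of a density with almost the same weighted norm. -/
theorem exists_lowerSemicontinuous_ge {f : Momentum → ℝ} (hf : ∀ p, 0 ≤ f p) (hm : AEMeasurable f)
    {δ : ENNReal} (hδ : δ ≠ 0) :
    ∃ F : Momentum → ENNReal, LowerSemicontinuous F ∧ (∀ p, ENNReal.ofReal (f p) ≤ F p) ∧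
      ∫⁻ p, ENNReal.ofReal √(energy p) * F p ≤ weightedL1Norm (1 / 2) f + δ := by
  have hmeas : AEMeasurable fun p => Real.toNNReal (√(energy p) * f p) :=
    (AEMeasurable.mul (Real.continuous_sqrt.comp continuous_energy).measurable.aemeasurable
      hm).real_toNNReal
  -- Vitali–Carathéodory is applied to `√p⁰ f`, so the error is measured in the weighted norm;
  -- dividing by the continuous positive weight preserves lower semicontinuity.
  obtain ⟨G, hfG, hG, hint⟩ :=
    exists_lt_lowerSemicontinuous_lintegral_ge_of_aemeasurable volume _ hmeas hδ
  have hs : ∀ p, 0 < √(energy p) := fun p => Real.sqrt_pos.2 (energy_pos p)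
  have hinv : ∀ p, ENNReal.ofReal √(energy p) * ENNReal.ofReal (1 / √(energy p)) = 1 := fun p => by
    rw [← ENNReal.ofReal_mul (hs p).le, mul_one_div_cancel (hs p).ne', ENNReal.ofReal_one]
  refine ⟨fun p => ENNReal.ofReal (1 / √(energy p)) * G p, fun p => ?_, fun p => ?_, ?_⟩
  · refine LowerSemicontinuousAt.ennreal_mul ?_ (hG p)
    exact (ENNReal.continuous_ofReal.comp (Continuous.div continuous_const (by fun_prop)
      fun p => (hs p).ne')).lowerSemicontinuous p
  · calc ENNReal.ofReal (f p) = ENNReal.ofReal (1 / √(energy p)) *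
          ENNReal.ofReal (√(energy p) * f p) := by
          rw [← ENNReal.ofReal_mul (by positivity), one_div, inv_mul_cancel_left₀ (hs p).ne']
      _ ≤ _ := mul_le_mul_right (hfG p).le _
  · simp_rw [← mul_assoc, hinv, one_mul]
    refine hint.trans (add_le_add_left (le_of_eq (lintegral_congr fun p => ?_)) _)
    rw [abs_of_nonneg (hf p), ← Real.sqrt_eq_rpow]
    rfl

theorem lintegral_gain_hypersurfaceMeasure_le {c₁ c₂ : ℝ} (hc₂ : 0 < c₂)
    {σ : ℝ → ℝ → ℝ} (hσ : IsHardBall c₁ c₂ σ) {a : FourVector} (ha : IsSpaceLike a)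
    (b : FourVector) {f : Momentum → ℝ} (hf : ∀ p, 0 ≤ f p) (hf1 : MemWeightedL1 1 f) :
    ∫⁻ p, ENNReal.ofReal (energy p ^ (1 / 2 : ℝ)) * gain σ f f p ∂(hypersurfaceMeasure a b) ≤
      ENNReal.ofReal (24 * Real.pi * c₂ / √(lorentz a a)) * weightedL1Norm (1 / 2) f ^ 2 := by
  have key : ∀ δ : ENNReal, δ ≠ 0 →
      ∫⁻ p, ENNReal.ofReal (energy p ^ (1 / 2 : ℝ)) * gain σ f f p ∂(hypersurfaceMeasure a b) ≤
        ENNReal.ofReal (24 * Real.pi * c₂ / √(lorentz a a)) *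
          (weightedL1Norm (1 / 2) f + δ) ^ 2 := fun δ hδ => by
    obtain ⟨F, hF, hfF, hint⟩ := exists_lowerSemicontinuous_ge hf hf1.1 hδ
    calc _ ≤ ∫⁻ p, weightedGain c₂ F p ∂(hypersurfaceMeasure a b) := by
          refine lintegral_mono fun p => ?_
          rw [← Real.sqrt_eq_rpow]
          exact gain_le_weightedGain hσ hf hF.measurable hfF p
      _ ≤ ENNReal.ofReal (24 * Real.pi * c₂ / √(lorentz a a)) *
            (∫⁻ p, ENNReal.ofReal √(energy p) * F p) ^ 2 :=
          lintegral_hypersurfaceMeasure_le ha b (lowerSemicontinuous_weightedGain c₂ hF)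
            fun ε hε => lintegral_layer_weightedGain_le ha b hc₂ hF hε
      _ ≤ _ := by gcongr
  have hlim : Tendsto (fun δ : ENNReal => ENNReal.ofReal (24 * Real.pi * c₂ / √(lorentz a a)) *
      (weightedL1Norm (1 / 2) f + δ) ^ 2) (𝓝[≠] 0)
      (𝓝 (ENNReal.ofReal (24 * Real.pi * c₂ / √(lorentz a a)) *
        (weightedL1Norm (1 / 2) f + 0) ^ 2)) := by
    refine Tendsto.mono_left (Continuous.tendsto ?_ 0) nhdsWithin_le_nhds
    exact (ENNReal.continuous_const_mul ENNReal.ofReal_ne_top).comp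
      ((ENNReal.continuous_pow 2).comp (by fun_prop))
  rw [add_zero] at hlim
  exact ge_of_tendsto hlim (eventually_mem_nhdsWithin.mono key)

end RelBoltzmann

theorem proposition3p3 :
    -- the measures `δ⁽⁴⁾(p^μ + q^μ - p'^μ - q'^μ) dp' dq'` and `δ(a^μ (p_μ - b_μ)) dp` exist
    (∀ p q : RelBoltzmann.Momentum, p ≠ q →
      RelBoltzmann.IsDiracPullback (RelBoltzmann.conservationDefect p q)
        (RelBoltzmann.collisionMeasure p q)) ∧
    (∀ a b : RelBoltzmann.FourVector,
      RelBoltzmann.IsSpaceLike a → RelBoltzmann.IsEnergyMomentum b →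
      RelBoltzmann.IsDiracPullback (RelBoltzmann.hyperplaneFun a b)
        (RelBoltzmann.hypersurfaceMeasure a b)) ∧
    -- the estimate
    (∀ c₁ c₂ : ℝ, 0 < c₁ → 0 < c₂ →
      ∃ C : ℝ, 0 < C ∧
        ∀ σ : ℝ → ℝ → ℝ, RelBoltzmann.IsHardBall c₁ c₂ σ →
        ∀ a b : RelBoltzmann.FourVector,
          RelBoltzmann.IsSpaceLike a → RelBoltzmann.IsEnergyMomentum b →
        ∀ f : RelBoltzmann.Momentum → ℝ,
          (∀ p, 0 ≤ f p) → RelBoltzmann.MemWeightedL1 1 f →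
          ∫⁻ p, ENNReal.ofReal (RelBoltzmann.energy p ^ (1 / 2 : ℝ)) *
              RelBoltzmann.gain σ f f p ∂(RelBoltzmann.hypersurfaceMeasure a b)
            ≤ ENNReal.ofReal (C / √(RelBoltzmann.lorentz a a)) *
              RelBoltzmann.weightedL1Norm (1 / 2) f ^ 2) := by
  refine ⟨fun p q _ => ?_, fun a b ha _ => RelBoltzmann.isDiracPullback_hypersurfaceMeasure ha b,
    fun c₁ c₂ _ hc₂ => ⟨24 * Real.pi * c₂, by positivity, fun σ hσ a b ha _ f hf hf1 =>
      RelBoltzmann.lintegral_gain_hypersurfaceMeasure_le hc₂ hσ ha b hf hf1⟩⟩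
  rw [RelBoltzmann.collisionMeasure_eq]
  exact RelBoltzmann.isDiracPullback_pairMeasure p q
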